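/- **Setting.** Let $R$ be a finite commutative chain ring (with unity) whose maximal ideal is $\langle\gamma\rangle$, with $\gamma\neq 0=\gamma^2$, and let $|R/\langle\gamma\rangle|=p^m$ with $p$ prime and $m\ge 1$ (so $\operatorname{char}R\in\{p,p^2\}$). Let $\zeta\in R$ have multiplicative order $p^m-1$ and let $\mathcal T=\{0,1,\zeta,\dots,\zeta^{p^m-2}\}$ be the Teichmüller set. Let $s,n\ge 1$ with $\gcd(n,p)=1$, write $P=p^s$, $Q=p^{s-1}$, and let $\alpha_0\in\mathcal T\setminus\{0\}$. Let $x^n-\alpha_0=f_1\cdots f_r$ with $f_1,\dots,f_r\in R[x]$ monic, basic irreducible (irreducible modulo $\gamma$) and pairwise coprime, and for $1\le u<r$ let $v_u,w_u\in R[x]$ satisfy $v_uf_u^{P}+w_u\prod_{i>u}f_i^{P}=1$, $\deg w_u<\deg f_u^{P}$; put $w_r=1$. Fix $j$, and write $f=f_j$, $d=\deg f$. If $\operatorname{char}R=p$, put $k=f^{P}$. If $\operatorname{char}R=p^2$, write $p=\gamma z$ with $z\in\mathcal T\setminus\{0\}$, put $a_\ell=\frac1p\binom{P}{\ell Q}$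 for $1\le \ell\le p-1$, let $M$ be the remainder on division by $f^{P-Q}$ of $$\Big(\prod_{i\ne j}f_i\Big)^{Q}\Big(z\sum_{\ell=1}^{p-1}a_\ell(x^n-\alpha_0)^{(\ell-1)Q}\alpha_0^{P-\ell Q}\Big)w_j\prod_{i<j}v_i ,$$ and put $k=f^{P}+\gamma f^{Q}M$. For a polynomial $c\ne0$ let $c^*(x)=x^{\deg c}c(1/x)$, and let $0^*=0$. Let $\mathcal K=R[x]/\langle k\rangle$ and $\widehat{\mathcal K}=R[x]/\langle k^*\rangle$. The class of $x$ is a unit of $\widehat{\mathcal K}$, so integer powers of $x$ make sense there. Elements of $\mathcal K$ are represented by polynomials of degree $<\deg k=dP$, and for an ideal $\mathcal I$ of $\mathcal K$ let $\mathcal I^\perp=\{a\in\widehat{\mathcal K}: a\,c^*=0\text{ in }\widehat{\mathcal K}\text{ for all }c\in\mathcal I\}$ be its orthogonal complement. For $\omega,t\in\mathbb N$ and $G\in R[x]$ let $\kappa=\kappa(\omega,t,G)$ be the least $i\ge 0$ with $\gamma f^{i}\in\langle f^\omega+\gamma f^tG\rangle\subseteq\mathcal K$. Say that $G$ is *$(t,\ell)$-admissible*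 if either $G=0$, or $t<\ell$, $G$ is a unit in $\mathcal K$ and $G=\sum_{i=0}^{\ell-t-1}b_if^i$ with all $b_i\in\mathcal T[x]$ zero or of degree $<d$. * Type II: $\langle\gamma f^\tau\rangle$, $0\le\tau<P$. * Type III: $\langle f^\omega+\gamma f^tG\rangle$, $0<\omega<P$, $G$ $(t,\kappa)$-admissible. * Type IV: $\langle f^\omega+\gamma f^tG,\ \gamma f^\mu\rangle$, $0\le\mu<\kappa\le\omega<P$, $G$ $(t,\mu)$-admissible. For Types III and IV in characteristic $p^2$, there are $0\le\delta<P$ and $A\in R[x]$, with $A$ either $0$ or a unit in $\mathcal K$, such that $\gamma(M-G)=\gamma f^\delta A$ in $\mathcal K$; fix any such $\delta,A$. In $\widehat{\mathcal K}$ write $$\mathbf G=x^{d\omega-dt-\deg G}G^*,\qquad \mathbf M=x^{dP-dQ-\deg M}M^*,\qquad \mathbf A=x^{dP-dQ-d\delta-\deg A}A^*,\qquad h=f^*.$$ **Theorem.** The following hold. (a) $\{0\}^\perp=\widehat{\mathcal K}$. (b) $\mathcal K^\perp=\{0\}$. (c) If $\mathcal I=\langle\gamma f^\tau\rangle$ is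 of Type II, then $\mathcal I^\perp=\langle h^{P-\tau},\gamma\rangle$. (d) Let $\mathcal I=\langle f^\omega+\gamma f^tG\rangle$ be of Type III. (i) If $\operatorname{char}R=p$, then $\mathcal I^\perp$ equals 1. $\langle h^{P-\omega}\rangle$ if $G=0$; 2. $\langle h^{P-\omega}-\gamma\mathbf G h^{P-2\omega+t}\rangle$ if $G\ne0$, $P-2\omega+t\ge0$; 3. $\langle h^{\omega-t}-\gamma\mathbf G,\ \gamma h^{P-\omega}\rangle$ if $G\neq0$, $P-2\omega+t<0$. (ii) If $\operatorname{char}R=p^2$: when $G\ne0$, $t=\omega-P+Q$ and either $A=0$ or $A\neq 0$, $\delta\ge P-Q$, we have $\mathcal I=\langle f^\omega+\gamma f^{\omega-P+Q}M\rangle$. Furthermore $\mathcal I^\perp$ equals 1. $\langle h^{P-\omega}+\gamma\mathbf M h^{Q-\omega}\rangle$ if $G=0$, $\omega\le Q$; 2. $\langle h^{P-Q}+\gamma\mathbf M,\ \gamma h^{P-\omega}\rangle$ if $G=0$, $\omega>Q$; 3. $\langle h^{P-Q}+\gamma\mathbf M-\gamma\mathbf G h^{P+t-\omega-Q},\ \gamma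 h^{P-\omega}\rangle$ if $G\ne0$, $P-Q+t-\omega>0$, $\omega>Q$; 4. $\langle h^{P-\omega}+\gamma\mathbf M h^{Q-\omega}-\gamma\mathbf G h^{P+t-2\omega}\rangle$ if $G\ne0$, $P-Q+t-\omega>0$, $\omega\le Q$; 5. $\langle h^{P-\omega}+\gamma\mathbf M h^{Q-\omega}-\gamma\mathbf G h^{P+t-2\omega}\rangle$ if $G\ne0$, $P-Q+t-\omega<0$, $P-2\omega+t\ge0$; 6. $\langle h^{\omega-t}+\gamma\mathbf M h^{Q+\omega-t-P}-\gamma\mathbf G,\ \gamma h^{P-\omega}\rangle$ if $G\ne0$, $P-Q+t-\omega<0$, $P-2\omega+t<0$; 7. $\langle h^{P-\omega}\rangle$ if $G\ne0$, $\omega=P-Q+t$ and either $A=0$ or $A\ne0$, $\delta\ge P-Q$; 8. $\langle h^{P-\omega}+\gamma\mathbf A h^{Q-\omega+\delta}\rangle$ if $G\ne0$, $\omega=P-Q+t$, $A\ne0$, $\omega-Q\le\delta<P-Q$; 9. $\langle h^{P-Q-\delta}+\gamma\mathbf A,\ \gamma h^{P-\omega}\rangle$ if $G\ne0$, $\omega=P-Q+t$,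 $A\neq0$, $\delta<\omega-Q$. (e) Let $\mathcal I=\langle f^\omega+\gamma f^tG,\ \gamma f^\mu\rangle$ be of Type IV. (i) If $\operatorname{char}R=p$, then $\mathcal I^\perp$ equals 1. $\langle h^{P-\mu},\ \gamma h^{P-\omega}\rangle$ if $G=0$; 2. $\langle h^{P-\mu}-\gamma\mathbf G h^{P-\mu-\omega+t},\ \gamma h^{P-\omega}\rangle$ if $G\ne0$. (ii) If $\operatorname{char}R=p^2$: when $G\ne0$, $t=\omega-P+Q$ and either $A=0$ or $A\ne0$, $\delta\ge P-Q$, we have $\mathcal I=\langle f^\omega+\gamma f^{\omega-P+Q}M,\ \gamma f^\mu\rangle$. Furthermore $\mathcal I^\perp$ equals 1. $\langle h^{P-\mu},\ \gamma h^{P-\omega}\rangle$ if $G=0$, $P-Q-\omega+\mu\le0$; 2. $\langle h^{P-\mu}+\gamma\mathbf M h^{Q-\mu},\ \gamma h^{P-\omega}\rangle$ if $G=0$, $P-Q-\omega+\mu>0$; 3. $\langle h^{P-\mu}+\gamma\mathbf M h^{Q-\mu}-\gamma\mathbf G h^{P-\mu+t-\omega},\ \gamma h^{P-\omega}\rangle$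 if $G\ne0$, $P-Q+t-\omega\ne0$; 4. $\langle h^{P-\mu},\ \gamma h^{P-\omega}\rangle$ if $G\ne0$, $\omega=P-Q+t$ and either $A=0$ or $A\ne0$, $\delta\ge P-Q$; 5. $\langle h^{P-\mu}+\gamma\mathbf A h^{Q-\mu+\delta},\ \gamma h^{P-\omega}\rangle$ if $G\ne0$, $\omega=P-Q+t$, $A\ne0$, $\delta<P-Q$. -/

import Mathlib

open Polynomial

namespace ConstaDual

variable {R : Type*} [CommRing R]

/-- The Teichmüller set `{0, 1, ζ, ζ², …}` attached to `ζ`. -/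
def teich (ζ : R) : Set R := insert 0 (Set.range fun i : ℕ => ζ ^ i)

/-- Polynomials with all coefficients in `S` that are zero or of degree `< d`. -/
def polyLT (S : Set R) (d : ℕ) : Set R[X] := {g | (∀ i, g.coeff i ∈ S) ∧ g.degree < d}

/-- The quotient ring `R[x]/⟨k⟩`. -/
abbrev K (k : R[X]) : Type _ := R[X] ⧸ Ideal.span {k}

/-- The quotient ring `R[x]/⟨k*⟩`, where `k*(x) = x ^ (deg k) k(1/x)`. -/
abbrev Khat (k : R[X]) : Type _ := R[X] ⧸ Ideal.span {k.reverse}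

/-- The class of a polynomial in `R[x]/⟨k⟩`. -/
noncomputable abbrev toK (k : R[X]) : R[X] →+* K k := Ideal.Quotient.mk (Ideal.span {k})

/-- The class of a polynomial in `R[x]/⟨k*⟩`. -/
noncomputable abbrev toKhat (k : R[X]) : R[X] →+* Khat k := Ideal.Quotient.mk (Ideal.span {k.reverse})

/-- The orthogonal complement of `I ⊆ R[x]/⟨k⟩`: all `a ∈ R[x]/⟨k*⟩` with `a c* = 0` in
`R[x]/⟨k*⟩` for all `c ∈ I`, where `c` is represented by its unique representative of degree
`< deg k` and `c*(x) = x ^ (deg c) c(1/x)`, `0* = 0`. -/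
def orth (k : R[X]) (I : Ideal (K k)) : Set (Khat k) :=
  {a | ∀ c : R[X], c.degree < k.degree → toK k c ∈ I → a * toKhat k c.reverse = 0}

/-- For monic `k` the class of `x` is invertible in `R[x]/⟨k*⟩`. -/
theorem isUnit_X_Khat {k : R[X]} (hk : k.Monic) : IsUnit (toKhat k X) := by
  have h1 : X * k.reverse.divX + 1 = k.reverse := by
    have h := X_mul_divX_add k.reverse
    rwa [coeff_zero_reverse, hk.leadingCoeff, C_1] at h
  have h0 : toKhat k (X * k.reverse.divX + 1) = 0 :=
    by
    rw [Ideal.Quotient.eq_zero_iff_mem, h1]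
    exact Ideal.mem_span_singleton_self _
  rw [map_add, map_mul, map_one] at h0
  refine IsUnit.of_mul_eq_one (-(toKhat k k.reverse.divX)) ?_
  linear_combination -h0

open Classical in
/-- `x ^ e` in `R[x]/⟨k*⟩` for an integer `e` (`x` is a unit there when `k` is monic). -/
noncomputable def xpow (k : R[X]) (e : ℤ) : Khat k :=
  if 0 ≤ e then toKhat k X ^ e.toNat else Ring.inverse (toKhat k X) ^ (-e).toNat

/-- `x ^ (e - deg H) H*(x)` in `R[x]/⟨k*⟩`. -/
noncomputable def xStar (k : R[X]) (e : ℤ) (H : R[X]) : Khat k :=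
  xpow k (e - (H.natDegree : ℤ)) * toKhat k H.reverse

/-- The ideal `⟨f ^ ω + γ f ^ t G⟩` of `R[x]/⟨k⟩`. -/
noncomputable def ideal3 (γ : R) (k f : R[X]) (ω t : ℕ) (G : R[X]) : Ideal (K k) :=
  Ideal.span {toK k (f ^ ω + C γ * f ^ t * G)}

/-- The ideal `⟨f ^ ω + γ f ^ t G, γ f ^ μ⟩` of `R[x]/⟨k⟩`. -/
noncomputable def ideal4 (γ : R) (k f : R[X]) (ω t : ℕ) (G : R[X]) (μ : ℕ) : Ideal (K k) :=
  Ideal.span {toK k (f ^ ω + C γ * f ^ t * G), toK k (C γ * f ^ μ)}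

/-- `κ` is the least natural number with `γ f ^ κ ∈ ⟨f ^ ω + γ f ^ t G⟩`. -/
def IsKappa (γ : R) (k f : R[X]) (ω t : ℕ) (G : R[X]) (κ : ℕ) : Prop :=
  IsLeast {i : ℕ | toK k (C γ * f ^ i) ∈ ideal3 γ k f ω t G} κ

/-- `G` is either `0`, or `t < ℓ` and `G` is a unit of `R[x]/⟨k⟩` of the form
`∑ i < ℓ - t, aᵢ f ^ i`, where the `aᵢ` have Teichmüller coefficients and degree `< deg f`. -/
def IsCoeff (ζ : R) (k f : R[X]) (t ℓ : ℕ) (G : R[X]) : Prop :=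
  G = 0 ∨ (t < ℓ ∧ IsUnit (toK k G) ∧
    ∃ a : ℕ → R[X], (∀ i, a i ∈ polyLT (teich ζ) f.natDegree) ∧
      G = ∑ i ∈ Finset.range (ℓ - t), a i * f ^ i)

/-- The parameters `(ω, t, G)` define an ideal `⟨f ^ ω + γ f ^ t G⟩` of Type III. -/
def IsType3 (γ ζ : R) (k f : R[X]) (P ω t : ℕ) (G : R[X]) : Prop :=
  0 < ω ∧ ω < P ∧ ∃ κ, IsKappa γ k f ω t G κ ∧ κ ≤ ω ∧ IsCoeff ζ k f t κ G

/-- The parameters `(ω, t, G, μ)` define an ideal `⟨f ^ ω + γ f ^ t G, γ f ^ μ⟩` of Type IV. -/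
def IsType4 (γ ζ : R) (k f : R[X]) (P ω t : ℕ) (G : R[X]) (μ : ℕ) : Prop :=
  ω < P ∧ ∃ κ, IsKappa γ k f ω t G κ ∧ μ < κ ∧ κ ≤ ω ∧ IsCoeff ζ k f t μ G

/-- `γ (M - G) = γ f ^ δ A` in `R[x]/⟨k⟩` with `δ < P` and `A` either `0` or a unit. -/
def IsDecomp (γ : R) (k f : R[X]) (P : ℕ) (M G : R[X]) (δ : ℕ) (A : R[X]) : Prop :=
  δ < P ∧ (A = 0 ∨ IsUnit (toK k A)) ∧
    toK k (C γ * (M - G)) = toK k (C γ * f ^ δ * A)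

/-- `z ∑_{ℓ=1}^{p-1} a_ℓ (x ^ n - α₀) ^ ((ℓ-1) p^(s-1)) α₀ ^ (p^s - ℓ p^(s-1))`, where
`a_ℓ = binom (p^s) (ℓ p^(s-1)) / p` (an exact division). -/
noncomputable def binomSum (p s n : ℕ) (α₀ z : R) : R[X] :=
  C z * ∑ l ∈ Finset.Icc 1 (p - 1),
    C ((((p ^ s).choose (l * p ^ (s - 1)) / p : ℕ) : R)) *
      (X ^ n - C α₀) ^ ((l - 1) * p ^ (s - 1)) * C (α₀ ^ (p ^ s - l * p ^ (s - 1)))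

/-- The polynomial `M_j`, so that `f_j ^ (p^s) + γ f_j ^ (p^(s-1)) M_j` is the monic factor of
`x ^ (n p^s) - α₀ ^ (p^s)` that lifts a power of `f_j`. It is the remainder modulo
`f_j ^ (p^s - p^(s-1))` of
`(∏_{i ≠ j} f_i) ^ (p^(s-1)) (z ∑ ⋯) w_j ∏_{i < j} v_i`, where `w_j` is read as `1` for the last
index. -/
noncomputable def polyM (p s n : ℕ) (α₀ z : R) {r : ℕ} (f v w : Fin r → R[X]) (j : Fin r) : R[X] :=
  ((∏ i ∈ Finset.univ.erase j, f i) ^ p ^ (s - 1) * binomSum p s n α₀ z *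
    (if (j : ℕ) + 1 < r then w j else 1) * ∏ i ∈ Finset.Iio j, v i) %ₘ
      (f j ^ (p ^ s - p ^ (s - 1)))

end ConstaDual

/-! The orthogonal complement is a transported annihilator. Since `g` divides `X ^ n - C α₀` with
`α₀` a unit and `n > 0`, the class of `x` is a unit of `K k`, and `x ↦ x⁻¹` gives an isomorphism
`revHom` from `K k` to `Khat k`. It sends `c` to `c*` up to a power of the unit `x`, so `orth k I`
is the image of the annihilator of `I` (`orth_eq_map`).

Annihilators follow from three relations, collected in `IsNilExt`: γ² = 0, f^P = -γ f^Q M, and γ f^i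
a = 0 only for a in ⟨f^(P-i), γ⟩. In characteristic p one takes M = 0. Multiplying f^ω + γ f^t G by
f^(P-ω) gives -γ D with D = f^Q M - f^(t+P-ω) G. If γ D = γ f^μ N with μ ≤ ω, then
`annihilator_pair` identifies the annihilator of ⟨f^ω + γ f^t G, γ f^μ⟩ as ⟨f^(P-μ) + γ N, γ
f^(P-ω)⟩.

The case list records how D factors. If Q and t+P-ω differ, D is f to the smaller exponent times a
unit, because M and a nonzero G are units and f is nilpotent; for G = 0 it is f^Q M. If they agree,
γ D = γ f^(Q+δ) A. So unless γ D = 0, γ D = γ f^e U with U a unit; then γ f^e lies in the Type III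
ideal and κ ≤ e. For Type III the pair formula is applied with μ = e when e < ω, and with μ = ω
otherwise, when one generator suffices. For Type IV, μ < κ ≤ e lets f^μ be factored out.

That M is a unit rests on binom(p^s, p^(s-1)) having p-adic valuation exactly 1. -/

namespace ConstaDual

/-! ### Annihilators from the relations of a nilpotent extension -/

section Annihilator

/-- The relations of `R[x]/⟨f ^ P + γ f ^ Q M⟩` that determine annihilators. -/
structure IsNilExt {A : Type*} [CommRing A] (γ f M : A) (P Q : ℕ) : Prop where
  sq_zero : γ * γ = 0
  pow_eq : f ^ P = -(γ * f ^ Q * M)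
  exists_of_mul_eq_zero : ∀ i ≤ P, ∀ a, γ * f ^ i * a = 0 → ∃ b c, a = f ^ (P - i) * b + γ * c

namespace IsNilExt

variable {A : Type*} [CommRing A] {γ f M : A} {P Q : ℕ}

theorem mul_pow_eq_zero (h : IsNilExt γ f M P Q) {e : ℕ} (he : P ≤ e) : γ * f ^ e = 0 := by
  obtain ⟨e, rfl⟩ := Nat.exists_eq_add_of_le he
  rw [pow_add, h.pow_eq]
  linear_combination -(f ^ Q * M * f ^ e) * h.sq_zero

theorem isNilpotent (h : IsNilExt γ f M P Q) : IsNilpotent f := by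
  refine ⟨P + P, ?_⟩
  rw [pow_add]
  nth_rw 1 [h.pow_eq]
  linear_combination -(f ^ Q * M) * h.mul_pow_eq_zero le_rfl

theorem isUnit_add_pow_mul (h : IsNilExt γ f M P Q) {U : A} (hU : IsUnit U) {e : ℕ} (he : e ≠ 0)
    (a : A) : IsUnit (U + f ^ e * a) := by
  refine IsNilpotent.isUnit_add_left_of_commute ?_ hU (Commute.all _ _)
  exact (Commute.all _ _).isNilpotent_mul_right ((h.isNilpotent).pow_of_pos he)

theorem annihilator_mul_pow (h : IsNilExt γ f M P Q) {τ : ℕ} (hτ : τ ≤ P) :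
    Submodule.annihilator (Ideal.span {γ * f ^ τ}) = Ideal.span {f ^ (P - τ), γ} := by
  ext a
  rw [Submodule.mem_annihilator_span_singleton, Ideal.mem_span_pair, smul_eq_mul]
  constructor
  · intro ha
    obtain ⟨b, c, rfl⟩ := h.exists_of_mul_eq_zero τ hτ a (by rw [mul_comm, ha])
    exact ⟨b, c, by ring⟩
  · rintro ⟨b, c, rfl⟩
    have h1 : γ * (f ^ (P - τ) * f ^ τ) = 0 := by
      rw [← pow_add, Nat.sub_add_cancel hτ]; exact h.mul_pow_eq_zero le_rfl
    linear_combination b * h1 + c * f ^ τ * h.sq_zero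

/-- The two leading generators multiply to f^(ω-μ) (f^P + γ f^μ N + γ f^(t+P-ω) G), and `hN` turns
the bracket into f^P + γ f^Q M = 0. Conversely, killing γ f^μ forces a = f^(P-μ) b + γ c; removing b
(f^(P-μ) + γ N) leaves γ (c - N b), which must be killed by f^ω, so the third relation applies a
second time. -/
theorem annihilator_pair (h : IsNilExt γ f M P Q) {ω μ t : ℕ} {G N : A} (hω : ω ≤ P) (hμ : μ ≤ ω)
    (hN : γ * (f ^ Q * M - f ^ (t + P - ω) * G) = γ * f ^ μ * N) :
    Submodule.annihilator (Ideal.span {f ^ ω + γ * f ^ t * G, γ * f ^ μ}) =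
      Ideal.span {f ^ (P - μ) + γ * N, γ * f ^ (P - ω)} := by
  obtain ⟨u, rfl⟩ := Nat.exists_eq_add_of_le hμ
  obtain ⟨v, rfl⟩ := Nat.exists_eq_add_of_le hω
  have e1 : t + (μ + u + v) - (μ + u) = t + v := by omega
  have e2 : μ + u + v - μ = u + v := by omega
  have e3 : μ + u + v - (μ + u) = v := by omega
  rw [e1] at hN
  rw [e2, e3]
  have hP := h.pow_eq
  have h0 := h.mul_pow_eq_zero le_rfl
  have hs := h.sq_zero
  have h1 : (f ^ (μ + u) + γ * f ^ t * G) * (f ^ (u + v) + γ * N) = 0 := by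
    simp only [pow_add] at *
    linear_combination f ^ u * hP - f ^ u * hN + f ^ t * G * N * hs
  ext a
  rw [Submodule.mem_annihilator_span, Ideal.mem_span_pair]
  simp only [Subtype.forall, Set.mem_insert_iff, Set.mem_singleton_iff, forall_eq_or_imp,
    forall_eq, smul_eq_mul]
  constructor
  · rintro ⟨ha, hb⟩
    obtain ⟨b, c, rfl⟩ := h.exists_of_mul_eq_zero μ (by omega) a (by rw [mul_comm, hb])
    rw [e2] at *
    obtain ⟨b', c', hc⟩ := h.exists_of_mul_eq_zero (μ + u) hω (c - N * b) (by
      linear_combination ha - b * h1 - f ^ t * G * (c - N * b) * hs)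
    rw [e3] at hc
    exact ⟨b, b', by linear_combination -γ * hc - c' * hs⟩
  · rintro ⟨b, c, rfl⟩
    simp only [pow_add] at *
    constructor
    · linear_combination b * h1 + c * h0 + c * f ^ v * f ^ t * G * hs
    · linear_combination b * h0 + (b * N * f ^ μ + c * f ^ v * f ^ μ) * hs

theorem mul_pow_mem (h : IsNilExt γ f M P Q) {ω κ t : ℕ} {G U : A} (hω : ω ≤ P)
    (hU : γ * (f ^ Q * M - f ^ (t + P - ω) * G) = γ * f ^ κ * U) (hu : IsUnit U) :
    γ * f ^ κ ∈ Ideal.span {f ^ ω + γ * f ^ t * G} := by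
  obtain ⟨v, rfl⟩ := Nat.exists_eq_add_of_le hω
  have e1 : t + (ω + v) - ω = t + v := by omega
  rw [e1] at hU
  obtain ⟨U', hU'⟩ := hu.exists_right_inv
  have hP := h.pow_eq
  rw [Ideal.mem_span_singleton']
  -- Multiplication by f^(P-ω) turns the generator into -γ f^κ U; the remaining factor -U' inverts
  -- the unit.
  refine ⟨-(f ^ v * U'), ?_⟩
  simp only [pow_add] at *
  linear_combination -U' * hP + U' * hU + γ * f ^ κ * hU'

theorem mul_pow_self_mem (h : IsNilExt γ f M P Q) (ω t : ℕ) (G : A) :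
    γ * f ^ ω ∈ Ideal.span {f ^ ω + γ * f ^ t * G} := by
  rw [Ideal.mem_span_singleton']
  exact ⟨γ, by linear_combination f ^ t * G * h.sq_zero⟩

/-- A unit cofactor puts γ f^κ inside the principal ideal, so adjoining it changes nothing and the
pair formula applies. -/
theorem annihilator_of_unit (h : IsNilExt γ f M P Q) {ω κ t : ℕ} {G U : A} (hω : ω ≤ P)
    (hκ : κ ≤ ω) (hU : γ * (f ^ Q * M - f ^ (t + P - ω) * G) = γ * f ^ κ * U) (hu : IsUnit U) :
    Submodule.annihilator (Ideal.span {f ^ ω + γ * f ^ t * G}) =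
      Ideal.span {f ^ (P - κ) + γ * U, γ * f ^ (P - ω)} := by
  rw [← h.annihilator_pair hω hκ hU, Ideal.span_pair_comm,
    Ideal.span_insert, sup_eq_right.2]
  rw [Ideal.span_singleton_le_iff_mem]
  exact h.mul_pow_mem hω hU hu

/-- The pair formula with μ = ω: γ f^ω is γ times the generator, and likewise γ f^(P-ω) is γ times
f^(P-ω) + γ U, so the second generator is redundant on both sides. No unit is needed. -/
theorem annihilator_of_pow (h : IsNilExt γ f M P Q) {ω t : ℕ} {G U : A} (hω : ω ≤ P)
    (hU : γ * (f ^ Q * M - f ^ (t + P - ω) * G) = γ * f ^ ω * U) :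
    Submodule.annihilator (Ideal.span {f ^ ω + γ * f ^ t * G}) =
      Ideal.span {f ^ (P - ω) + γ * U} := by
  have h1 : Ideal.span {f ^ (P - ω) + γ * U} =
      Ideal.span {f ^ (P - ω) + γ * U, γ * f ^ (P - ω)} := by
    rw [Ideal.span_pair_comm, Ideal.span_insert, sup_eq_right.2]
    rw [Ideal.span_singleton_le_iff_mem, Ideal.mem_span_singleton']
    exact ⟨γ, by linear_combination U * h.sq_zero⟩
  rw [h1, ← h.annihilator_pair hω le_rfl hU, Ideal.span_pair_comm,
    Ideal.span_insert, sup_eq_right.2]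
  rw [Ideal.span_singleton_le_iff_mem]
  exact h.mul_pow_self_mem ω t G

/-- Changing `f ^ t G` by a multiple of `f ^ ω` does not change `⟨f ^ ω + γ f ^ t G⟩`. -/
theorem span_congr (h : IsNilExt γ f M P Q) {ω t t' : ℕ} {G G' B : A}
    (hB : γ * (f ^ t' * G') = γ * (f ^ t * G) + γ * f ^ ω * B) :
    Ideal.span {f ^ ω + γ * f ^ t * G} = Ideal.span {f ^ ω + γ * f ^ t' * G'} := by
  apply le_antisymm <;> rw [Ideal.span_singleton_le_iff_mem, Ideal.mem_span_singleton']
  · exact ⟨1 - γ * B, by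
      linear_combination hB - B * f ^ t' * G' * h.sq_zero⟩
  · exact ⟨1 + γ * B, by
      linear_combination -hB + B * f ^ t * G * h.sq_zero⟩

end IsNilExt
end Annihilator

/-! ### Reversal of polynomials as the substitution x ↦ x⁻¹ -/

section Reversal

variable {R : Type*} [CommRing R] {k : R[X]}

/-- The ring homomorphism `R[x]/⟨k⟩ → R[x]/⟨k*⟩` sending `x` to `x⁻¹`. -/
noncomputable def revHom (hk : k.Monic) : K k →+* Khat k :=
  Ideal.Quotient.lift _ (eval₂RingHom ((toKhat k).comp C)
    (((isUnit_X_Khat hk).unit⁻¹ : (Khat k)ˣ) : Khat k)) <| by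
    intro a ha
    obtain ⟨b, rfl⟩ := Ideal.mem_span_singleton'.1 ha
    rw [map_mul]
    refine mul_eq_zero_of_right _ ?_
    let : Invertible (((isUnit_X_Khat hk).unit⁻¹ : (Khat k)ˣ) : Khat k) :=
      Units.invertible _
    -- k(x⁻¹) is k*(x) times a power of x⁻¹, hence zero modulo k*.
    rw [coe_eval₂RingHom, ← eval₂_reverse_mul_pow]
    refine mul_eq_zero_of_left ?_ _
    have h1 : (⅟(((isUnit_X_Khat hk).unit⁻¹ : (Khat k)ˣ) : Khat k)) = toKhat k X := by
      rw [invOf_units, inv_inv, IsUnit.unit_spec]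
    rw [h1, ← hom_eval₂, eval₂_C_X, Ideal.Quotient.eq_zero_iff_mem]
    exact Ideal.mem_span_singleton_self _

theorem revHom_toK (hk : k.Monic) (c : R[X]) :
    revHom hk (toK k c) = eval₂ ((toKhat k).comp C)
      (((isUnit_X_Khat hk).unit⁻¹ : (Khat k)ˣ) : Khat k) c := rfl

@[simp] theorem revHom_C (hk : k.Monic) (c : R) : revHom hk (toK k (C c)) = toKhat k (C c) := by
  rw [revHom_toK, eval₂_C]; rfl

theorem toKhat_reverse (hk : k.Monic) (c : R[X]) :
    toKhat k c.reverse = toKhat k X ^ c.natDegree * revHom hk (toK k c) := by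
  let : Invertible (((isUnit_X_Khat hk).unit⁻¹ : (Khat k)ˣ) : Khat k) :=
      Units.invertible _
  have h1 : (⅟(((isUnit_X_Khat hk).unit⁻¹ : (Khat k)ˣ) : Khat k)) = toKhat k X := by
    rw [invOf_units, inv_inv, IsUnit.unit_spec]
  rw [revHom_toK, ← eval₂_reverse_mul_pow, h1, ← hom_eval₂, eval₂_C_X, mul_left_comm, ← mul_pow,
    IsUnit.mul_val_inv, one_pow, mul_one]

/-- The inverse also substitutes x⁻¹ for x. It is well defined because x is a unit modulo k and
k*(x⁻¹) x^(deg k) = k(x) = 0. -/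
theorem bijective_revHom (hk : k.Monic) (hX : IsUnit (toK k X)) :
    Function.Bijective (revHom hk) := by
  let : Invertible (toK k X) := hX.invertible
  let ψ : Khat k →+* K k := Ideal.Quotient.lift _ (eval₂RingHom ((toK k).comp C) (⅟(toK k X))) <| by
    intro a ha
    obtain ⟨b, rfl⟩ := Ideal.mem_span_singleton'.1 ha
    rw [map_mul]
    refine mul_eq_zero_of_right _ ?_
    have h := eval₂_reverse_mul_pow ((toK k).comp C) (toK k X) k
    rw [← hom_eval₂ k C, eval₂_C_X, Ideal.Quotient.eq_zero_iff_mem.2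
      (Ideal.mem_span_singleton_self _)] at h
    exact (hX.pow _).mul_left_eq_zero.1 h
  have hψX : ψ (toKhat k X) = ⅟(toK k X) := eval₂_X _ _
  have hψC (c : R) : ψ (toKhat k (C c)) = toK k (C c) := eval₂_C _ _
  have hφX : revHom hk (toK k X) = (((isUnit_X_Khat hk).unit⁻¹ : (Khat k)ˣ) : Khat k) :=
    eval₂_X _ _
  have h1 : ψ.comp (revHom hk) = RingHom.id _ := by
    refine Ideal.Quotient.ringHom_ext (Polynomial.ringHom_ext (fun c => ?_) ?_)
    · change ψ (revHom hk (toK k (C c))) = toK k (C c)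
      rw [revHom_C, hψC]
    · change ψ (revHom hk (toK k X)) = toK k X
      have h2 : ψ (toKhat k X) * ψ (revHom hk (toK k X)) = 1 := by
        rw [hφX, ← map_mul, IsUnit.mul_val_inv, map_one]
      rw [hψX] at h2
      calc _ = toK k X * (⅟(toK k X) * ψ (revHom hk (toK k X))) := by
            rw [← mul_assoc, mul_invOf_self, one_mul]
        _ = _ := by rw [h2, mul_one]
  have h2 : (revHom hk).comp ψ = RingHom.id _ := by
    refine Ideal.Quotient.ringHom_ext (Polynomial.ringHom_ext (fun c => ?_) ?_)
    · change revHom hk (ψ (toKhat k (C c))) = toKhat k (C c)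
      rw [hψC, revHom_C]
    · change revHom hk (ψ (toKhat k X)) = toKhat k X
      rw [hψX]
      have h3 : revHom hk (⅟(toK k X)) * revHom hk (toK k X) = 1 := by
        rw [← map_mul, invOf_mul_self, map_one]
      rw [hφX] at h3
      calc _ = revHom hk (⅟(toK k X)) * (((isUnit_X_Khat hk).unit⁻¹ : (Khat k)ˣ) : Khat k)
            * toKhat k X := by rw [mul_assoc, IsUnit.val_inv_mul, mul_one]
        _ = _ := by rw [h3, one_mul]
  exact ⟨Function.LeftInverse.injective (RingHom.congr_fun h1),
    Function.RightInverse.surjective (RingHom.congr_fun h2)⟩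

/-- The factor x^(deg c) relating c* to the image of c is a unit, so its dependence on the chosen c
does not affect the vanishing condition. -/
theorem orth_eq_map (hk : k.Monic) (hX : IsUnit (toK k X)) (I : Ideal (K k)) :
    orth k I = (Ideal.map (revHom hk) (Submodule.annihilator I) : Set (Khat k)) := by
  obtain ⟨hinj, hsurj⟩ := bijective_revHom hk hX
  ext a
  obtain ⟨a, rfl⟩ := hsurj a
  rw [SetLike.mem_coe, Ideal.mem_map_iff_of_surjective _ hsurj]
  have hu : ∀ c : R[X], revHom hk a * toKhat k c.reverse = 0 ↔ a * toK k c = 0 := by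
    intro c
    rw [toKhat_reverse hk, mul_left_comm, ((isUnit_X_Khat hk).pow _).mul_right_eq_zero, ← map_mul,
      map_eq_zero_iff _ hinj]
  have : revHom hk a ∈ orth k I ↔ a ∈ Submodule.annihilator I := by
    rw [Submodule.mem_annihilator]
    constructor
    · intro h y hy
      -- The remainder modulo k has degree below deg k only over a nontrivial `R`; a trivial `R`
      -- would make `K k` trivial.
      nontriviality K k
      obtain ⟨c, rfl⟩ := Ideal.Quotient.mk_surjective y
      have hR : Nontrivial R := by
        by_contra hR
        rw [not_nontrivial_iff_subsingleton] at hR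
        have : (1 : K k) = 0 := by
          rw [← map_one (toK k), Subsingleton.elim (1 : R[X]) 0, map_zero]
        exact one_ne_zero this
      have hc : toK k (c %ₘ k) = toK k c := by
        rw [Ideal.Quotient.eq, Ideal.mem_span_singleton]
        exact ⟨-(c /ₘ k), by linear_combination modByMonic_add_div c k⟩
      have h3 := h (c %ₘ k) (degree_modByMonic_lt c hk) (by rw [hc]; exact hy)
      rwa [hu, hc] at h3
    · intro h c _ hc
      rw [hu]
      exact h _ hc
  rw [this]
  exact ⟨fun h => ⟨a, h, rfl⟩, fun ⟨b, hb, hba⟩ => hinj hba ▸ hb⟩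

/-- `x ^ e` times the image of `y` under `x ↦ x⁻¹`. -/
noncomputable def twist (hk : k.Monic) (e : ℤ) (y : K k) : Khat k :=
  (((isUnit_X_Khat hk).unit ^ e : (Khat k)ˣ) : Khat k) * revHom hk y

theorem twist_mul (hk : k.Monic) (e e' : ℤ) (y y' : K k) :
    twist hk e y * twist hk e' y' = twist hk (e + e') (y * y') := by
  rw [twist, twist, twist, zpow_add, map_mul, Units.val_mul]; ring

theorem twist_add (hk : k.Monic) (e : ℤ) (y y' : K k) :
    twist hk e y + twist hk e y' = twist hk e (y + y') := by
  rw [twist, twist, twist, map_add]; ring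

theorem twist_sub (hk : k.Monic) (e : ℤ) (y y' : K k) :
    twist hk e y - twist hk e y' = twist hk e (y - y') := by
  rw [twist, twist, twist, map_sub]; ring

theorem toKhat_C_eq_twist (hk : k.Monic) (c : R) : toKhat k (C c) = twist hk 0 (toK k (C c)) := by
  rw [twist, revHom_C, zpow_zero, Units.val_one, one_mul]

theorem toKhat_reverse_pow (hk : k.Monic) (g : R[X]) (n : ℕ) :
    toKhat k g.reverse ^ n = twist hk (g.natDegree * n) (toK k g ^ n) := by
  rw [twist, toKhat_reverse hk, mul_pow, map_pow, ← pow_mul]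
  congr 1

theorem xpow_eq (hk : k.Monic) (e : ℤ) :
    xpow k e = (((isUnit_X_Khat hk).unit ^ e : (Khat k)ˣ) : Khat k) := by
  rw [xpow]
  split_ifs with h
  · conv_rhs => rw [← Int.toNat_of_nonneg h]
    rw [zpow_natCast, Units.val_pow_eq_pow_val]
    rfl
  · have h1 : e = -(((-e).toNat : ℕ) : ℤ) := by omega
    conv_rhs => rw [h1]
    rw [zpow_neg, zpow_natCast, ← inv_pow, Units.val_pow_eq_pow_val, ← Ring.inverse_unit]
    rfl

theorem xStar_eq_twist (hk : k.Monic) (e : ℤ) (H : R[X]) :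
    xStar k e H = twist hk e (toK k H) := by
  rw [xStar, xpow_eq hk, toKhat_reverse hk, twist, sub_eq_add_neg, zpow_add, Units.val_mul,
    zpow_neg, zpow_natCast, ← mul_assoc, mul_assoc (Units.val _)]
  congr 1
  have h1 : toKhat k X ^ H.natDegree =
      (((isUnit_X_Khat hk).unit ^ H.natDegree : (Khat k)ˣ) : Khat k) := by
    rw [Units.val_pow_eq_pow_val, IsUnit.unit_spec]
  rw [h1, Units.inv_mul, mul_one]

/-- The exponent carries no information about the ideal. It matters only that all summands of one
generator share it. -/
theorem span_twist (hk : k.Monic) (e : ℤ) (y : K k) :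
    Ideal.span {twist hk e y} = Ideal.map (revHom hk) (Ideal.span {y}) := by
  rw [Ideal.map_span, Set.image_singleton, twist, Ideal.span_singleton_mul_left_unit (Units.isUnit _)]

theorem span_twist_pair (hk : k.Monic) (e e' : ℤ) (y y' : K k) :
    Ideal.span {twist hk e y, twist hk e' y'} = Ideal.map (revHom hk) (Ideal.span {y, y'}) := by
  rw [Ideal.span_insert, Ideal.span_insert, Ideal.map_sup, span_twist, span_twist]

end Reversal
-- Reduction modulo γ over the chain ring
section ChainRing

variable {R : Type*} [CommRing R] [IsLocalRing R] {γ : R}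

open IsLocalRing in
theorem map_residue_eq_zero_iff (hmax : maximalIdeal R = Ideal.span {γ}) (c : R[X]) :
    c.map (residue R) = 0 ↔ ∃ q, c = C γ * q := by
  change _ ↔ C γ ∣ c
  rw [C_dvd_iff_dvd_coeff, Polynomial.ext_iff]
  simp only [coeff_map, coeff_zero, residue_eq_zero_iff, hmax, Ideal.mem_span_singleton]

open IsLocalRing in
-- A coefficient killed by γ ≠ 0 cannot be a unit, so it lies in ⟨γ⟩; conversely γ² = 0.
theorem C_mul_eq_zero_iff (hmax : maximalIdeal R = Ideal.span {γ}) (hγ0 : γ ≠ 0)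
    (hγ2 : γ ^ 2 = 0) (c : R[X]) : C γ * c = 0 ↔ c.map (residue R) = 0 := by
  constructor
  · intro h
    ext i
    have h1 : γ * c.coeff i = 0 := by rw [← coeff_C_mul, h, coeff_zero]
    rw [coeff_map, coeff_zero, residue_eq_zero_iff, mem_maximalIdeal, mem_nonunits_iff]
    exact fun hu => hγ0 (hu.mul_left_eq_zero.1 h1)
  · intro h
    obtain ⟨q, rfl⟩ := (map_residue_eq_zero_iff hmax c).1 h
    rw [← mul_assoc, ← C_mul, ← sq, hγ2, C_0, zero_mul]

variable {k g M : R[X]} {P Q : ℕ}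

theorem monic_of_degree_lt (hg : g.Monic) (hQP : Q ≤ P)
    (hM : M.degree < (g ^ (P - Q)).degree) (hk : k = g ^ P + C γ * g ^ Q * M) : k.Monic := by
  rw [hk]
  refine (hg.pow P).add_of_left ?_
  have h1 : g ^ P = g ^ Q * g ^ (P - Q) := by rw [← pow_add]; congr 1; omega
  rw [h1, mul_assoc, ← smul_eq_C_mul]
  refine (degree_smul_le _ _).trans_lt ?_
  rw [mul_comm (g ^ Q) M, mul_comm (g ^ Q), (hg.pow Q).degree_mul, (hg.pow Q).degree_mul]
  exact WithBot.add_lt_add_right (by rw [Ne, degree_eq_bot]; exact (hg.pow Q).ne_zero) hM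

open IsLocalRing in
-- A Bézout relation between b and g^P over the residue field lifts to u b + v g^P ≡ 1 modulo γ. In
-- the quotient g^P is itself a multiple of γ, so u b is 1 plus a nilpotent.
theorem isUnit_toK_of_isCoprime (hmax : maximalIdeal R = Ideal.span {γ})
    (hγ2 : γ ^ 2 = 0) (hk : k = g ^ P + C γ * g ^ Q * M) {b : R[X]}
    (hb : IsCoprime (b.map (residue R)) (g.map (residue R))) : IsUnit (toK k b) := by
  have hs : Function.Surjective (mapRingHom (residue R)) :=
    map_surjective _ Ideal.Quotient.mk_surjective
  obtain ⟨u, v, huv⟩ := (hb.pow_right (n := P))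
  obtain ⟨u, rfl⟩ := hs u
  obtain ⟨v, rfl⟩ := hs v
  rw [coe_mapRingHom] at huv
  obtain ⟨q, hq⟩ := (map_residue_eq_zero_iff hmax (u * b + v * g ^ P - 1)).1 (by
    rw [Polynomial.map_sub, Polynomial.map_add, Polynomial.map_mul, Polynomial.map_mul,
      Polynomial.map_pow, huv, Polynomial.map_one, sub_self])
  have h0 : toK k k = 0 :=
    Ideal.Quotient.eq_zero_iff_mem.2 (Ideal.mem_span_singleton_self _)
  have h1 : toK k u * toK k b = 1 + toK k (C γ) * toK k (q + v * g ^ Q * M) := by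
    rw [← map_mul, ← map_mul, ← map_one (toK k), ← map_add, ← sub_eq_zero, ← map_sub]
    have : u * b - (1 + C γ * (q + v * g ^ Q * M)) = -v * k := by
      rw [hk]; linear_combination hq
    rw [this, map_mul, h0, mul_zero]
  have h2 : IsUnit (toK k u * toK k b) := by
    rw [h1]
    refine IsNilpotent.isUnit_one_add ((Commute.all _ _).isNilpotent_mul_right ⟨2, ?_⟩)
    rw [← map_pow, ← C_pow, hγ2, C_0, map_zero]
  exact isUnit_of_mul_isUnit_right h2

open IsLocalRing in
-- For the third relation, suppose γ g^i c = k q. Modulo γ, k becomes a power of g over a field, so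
-- q = γ q'. Cancelling γ and then the reduction of g^i leaves c ≡ g^(P-i) q' modulo γ.
theorem isNilExt_toK (hmax : maximalIdeal R = Ideal.span {γ}) (hγ0 : γ ≠ 0)
    (hγ2 : γ ^ 2 = 0) (hg : g.Monic) (hk : k = g ^ P + C γ * g ^ Q * M) :
    IsNilExt (toK k (C γ)) (toK k g) (toK k M) P Q := by
  have h0 : toK k k = 0 :=
    Ideal.Quotient.eq_zero_iff_mem.2 (Ideal.mem_span_singleton_self _)
  have hg0 : g.map (residue R) ≠ 0 := (hg.map _).ne_zero
  have hγr : (C γ).map (residue R) = 0 :=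
    (map_residue_eq_zero_iff hmax _).2 ⟨1, (mul_one _).symm⟩
  have hkr : k.map (residue R) = g.map (residue R) ^ P := by
    rw [hk, Polynomial.map_add, Polynomial.map_mul, Polynomial.map_mul, hγr, zero_mul, zero_mul,
      add_zero, Polynomial.map_pow]
  refine ⟨?_, ?_, ?_⟩
  · rw [← map_mul, ← C_mul, ← sq, hγ2, C_0, map_zero]
  · have h1 : toK k (g ^ P + C γ * g ^ Q * M) = 0 := by rw [← hk]; exact h0
    simp only [map_add, map_mul, map_pow] at h1
    linear_combination h1
  · intro i hi a ha
    obtain ⟨c, rfl⟩ := Ideal.Quotient.mk_surjective a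
    have h1 : toK k (C γ * g ^ i * c) = 0 := by rw [map_mul, map_mul, map_pow]; exact ha
    obtain ⟨q, hq⟩ := Ideal.mem_span_singleton.1 (Ideal.Quotient.eq_zero_iff_mem.1 h1)
    have hq0 : q.map (residue R) = 0 := by
      have h2 := congrArg (Polynomial.map (residue R)) hq
      rw [Polynomial.map_mul, Polynomial.map_mul, Polynomial.map_mul, hγr, zero_mul, zero_mul,
        hkr] at h2
      exact (mul_eq_zero.1 h2.symm).resolve_left (pow_ne_zero _ hg0)
    obtain ⟨q, rfl⟩ := (map_residue_eq_zero_iff hmax q).1 hq0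
    have h3 : (g ^ i * c - k * q).map (residue R) = 0 := by
      rw [← C_mul_eq_zero_iff hmax hγ0 hγ2]
      linear_combination hq
    have h4 : (c - g ^ (P - i) * q).map (residue R) = 0 := by
      simp only [Polynomial.map_sub, Polynomial.map_mul, Polynomial.map_pow, hkr] at h3 ⊢
      refine (mul_eq_zero.1 (?_ : g.map (residue R) ^ i * _ = 0)).resolve_left (pow_ne_zero _ hg0)
      rw [← h3, ← Nat.add_sub_cancel' hi, pow_add, Nat.add_sub_cancel' hi]
      ring
    obtain ⟨q', hq'⟩ := (map_residue_eq_zero_iff hmax _).1 h4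
    refine ⟨toK k q, toK k q', ?_⟩
    change toK k c = _
    rw [← map_pow, ← map_mul, ← map_mul, ← map_add, ← hq', add_sub_cancel]

open IsLocalRing in
-- δ is the multiplicity of the irreducible g in M - G over the residue field. If it is at least P,
-- or M - G reduces to 0, then γ (M - G) vanishes in the quotient and A = 0 serves.
theorem exists_isDecomp (hmax : maximalIdeal R = Ideal.span {γ}) (hγ0 : γ ≠ 0)
    (hγ2 : γ ^ 2 = 0) (hg : g.Monic) (hgi : Irreducible (g.map (residue R)))
    (hP : P ≠ 0) (hk : k = g ^ P + C γ * g ^ Q * M) (G : R[X]) :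
    ∃ (δ : ℕ) (A : R[X]), IsDecomp γ k g P M G δ A := by
  have hs : Function.Surjective (mapRingHom (residue R)) :=
    map_surjective _ Ideal.Quotient.mk_surjective
  have hn := isNilExt_toK hmax hγ0 hγ2 hg hk
  have key (δ : ℕ) (b : R[X]) (hb : (M - G).map (residue R) = (g ^ δ * b).map (residue R)) :
      C γ * (M - G) = C γ * g ^ δ * b := by
    rw [← sub_eq_zero, mul_assoc, ← mul_sub, C_mul_eq_zero_iff hmax hγ0 hγ2, Polynomial.map_sub,
      hb, sub_self]
  by_cases hdvd : g.map (residue R) ^ P ∣ (M - G).map (residue R)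
  · obtain ⟨b, hb⟩ := hdvd
    obtain ⟨b, rfl⟩ := hs b
    refine ⟨0, 0, Nat.pos_of_ne_zero hP, Or.inl rfl, ?_⟩
    rw [key P b (by rw [hb, Polynomial.map_mul, Polynomial.map_pow]; rfl), mul_zero, map_zero,
      map_mul, map_mul, map_pow, hn.mul_pow_eq_zero le_rfl, zero_mul]
  · have h0 : (M - G).map (residue R) ≠ 0 := fun h => hdvd (h ▸ dvd_zero _)
    have hfin : FiniteMultiplicity (g.map (residue R)) ((M - G).map (residue R)) :=
      FiniteMultiplicity.of_prime_left hgi.prime h0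
    obtain ⟨b, hb, hndvd⟩ := hfin.exists_eq_pow_mul_and_not_dvd
    obtain ⟨b, rfl⟩ := hs b
    refine ⟨_, b, ?_, Or.inr ?_, congrArg (toK k) (key _ b (by
      rw [Polynomial.map_mul, Polynomial.map_pow]; exact hb))⟩
    · by_contra hle
      exact hdvd (hb ▸ (pow_dvd_pow _ (not_lt.1 hle)).mul_right _)
    · exact isUnit_toK_of_isCoprime hmax hγ2 hk ((hgi.coprime_iff_not_dvd.2 hndvd).symm)

end ChainRing

/-! ### Invertibility of M -/

section UnitM

theorem not_dvd_choose_div {p s : ℕ} (hp : p.Prime) (hs : 0 < s) :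
    ¬ p ∣ (p ^ s).choose (p ^ (s - 1)) / p := by
  have hle : p ^ (s - 1) ≤ p ^ s := Nat.pow_le_pow_right hp.pos (Nat.sub_le _ _)
  have h0 : (p ^ s).choose (p ^ (s - 1)) ≠ 0 := (Nat.choose_pos hle).ne'
  have h1 := Nat.factorization_choose_prime_pow hp hle (pow_ne_zero _ hp.ne_zero)
  rw [hp.factorization_pow, Finsupp.single_eq_same] at h1
  have h2 : ((p ^ s).choose (p ^ (s - 1))).factorization p = 1 := by omega
  have hd : p ∣ (p ^ s).choose (p ^ (s - 1)) := by
    have h3 := Nat.ordProj_dvd ((p ^ s).choose (p ^ (s - 1))) p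
    rwa [h2, pow_one] at h3
  intro h
  have h3 := mul_dvd_mul_left p h
  rw [Nat.mul_div_cancel' hd, ← sq, hp.pow_dvd_iff_le_factorization h0] at h3
  omega

theorem isUnit_natCast_of_not_dvd {R : Type*} [CommRing R] [IsLocalRing R] {p a : ℕ} (hp : p.Prime)
    (hpR : (p : R) ∈ IsLocalRing.maximalIdeal R) (ha : ¬ p ∣ a) : IsUnit (a : R) := by
  by_contra hnu
  obtain ⟨b, c, hab⟩ := Nat.isCoprime_iff_coprime.2 ((hp.coprime_iff_not_dvd).2 ha)
  have h1 : (b : R) * (p : R) + c * (a : R) = 1 := by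
    simpa only [Int.cast_add, Int.cast_mul, Int.cast_natCast, Int.cast_one] using
      congrArg (Int.cast : ℤ → R) hab
  have h2 : (1 : R) ∈ IsLocalRing.maximalIdeal R := by
    rw [← h1]
    exact Ideal.add_mem _ (Ideal.mul_mem_left _ _ hpR)
      (Ideal.mul_mem_left _ _ ((IsLocalRing.mem_maximalIdeal _).2 hnu))
  exact (IsLocalRing.mem_maximalIdeal _).1 h2 isUnit_one

/-- Modulo g only the term l = 1 survives, and it is a unit constant. -/
theorem isCoprime_mul_sum_pow {R : Type*} [CommRing R] {p Q : ℕ} (hp : 2 ≤ p) (hQ : Q ≠ 0)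
    {z : R} {a b : ℕ → R} (hz : IsUnit z) (ha : IsUnit (a 1)) (hb : IsUnit (b 1)) {g h : R[X]}
    (hg : g ∣ h) :
    IsCoprime (C z * ∑ l ∈ Finset.Icc 1 (p - 1), C (a l) * h ^ ((l - 1) * Q) * C (b l)) g := by
  have h1 : Finset.Icc 1 (p - 1) = insert 1 (Finset.Icc 2 (p - 1)) := by
    ext l; simp only [Finset.mem_insert, Finset.mem_Icc]; omega
  rw [h1, Finset.sum_insert (by simp)]
  have h2 : g ∣ ∑ l ∈ Finset.Icc 2 (p - 1), C (a l) * h ^ ((l - 1) * Q) * C (b l) := by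
    refine Finset.dvd_sum fun l hl => ?_
    rw [Finset.mem_Icc] at hl
    refine ((hg.trans (dvd_pow_self _ ?_)).mul_left _).mul_right _
    exact mul_ne_zero (by omega) hQ
  obtain ⟨q, hq⟩ := h2
  rw [hq, mul_add, mul_left_comm (C z) g q, Nat.sub_self, zero_mul, pow_zero, mul_one, ← C_mul, ← C_mul]
  refine IsCoprime.add_mul_left_left ?_ _
  obtain ⟨c, hc⟩ := (hz.mul (ha.mul hb)).exists_left_inv
  exact ⟨C c, 0, by rw [← C_mul, hc, zero_mul, add_zero, C_1]⟩

theorem isCoprime_binomSum {R : Type*} [CommRing R] [IsLocalRing R] {p s n : ℕ} (hp : p.Prime)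
    (hs : 0 < s) (hpR : (p : R) ∈ IsLocalRing.maximalIdeal R) {α₀ z : R} (hα : IsUnit α₀)
    (hz : IsUnit z) {g : R[X]} (hg : g ∣ X ^ n - C α₀) : IsCoprime (binomSum p s n α₀ z) g := by
  have h1 : IsUnit (((p ^ s).choose (p ^ (s - 1)) / p : ℕ) : R) :=
    isUnit_natCast_of_not_dvd hp hpR (not_dvd_choose_div hp hs)
  refine isCoprime_mul_sum_pow hp.two_le (pow_ne_zero _ hp.ne_zero)
    (a := fun l => (((p ^ s).choose (l * p ^ (s - 1)) / p : ℕ) : R))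
    (b := fun l => α₀ ^ (p ^ s - l * p ^ (s - 1))) hz ?_ (hα.pow _) hg
  simpa only [one_mul] using h1

/-- The polynomial `M` is invertible modulo `γ` and `f`. -/
theorem isCoprime_polyM {R : Type*} [CommRing R] [IsLocalRing R] {p s n r : ℕ} (hp : p.Prime)
    (hs : 0 < s) (hpR : (p : R) ∈ IsLocalRing.maximalIdeal R) {α₀ z : R} (hα : IsUnit α₀) (hz : IsUnit z)
    (f v w : Fin r → R[X])
    (hfcop : Pairwise fun i l => IsCoprime (f i) (f l)) (hfprod : ∏ i, f i = X ^ n - C α₀)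
    (hvw : ∀ u : Fin r, (u : ℕ) + 1 < r →
      v u * f u ^ p ^ s + w u * ∏ i ∈ Finset.Ioi u, f i ^ p ^ s = 1) (j : Fin r) :
    IsCoprime (polyM p s n α₀ z f v w j) (f j) := by
  have hp2 := hp.two_le
  have hlt : p ^ (s - 1) < p ^ s := Nat.pow_lt_pow_right hp.one_lt (by omega)
  have hps : p ^ s ≠ 0 := pow_ne_zero _ hp.ne_zero
  rw [polyM]
  set N := (∏ i ∈ Finset.univ.erase j, f i) ^ p ^ (s - 1) * binomSum p s n α₀ z *
    (if (j : ℕ) + 1 < r then w j else 1) * ∏ i ∈ Finset.Iio j, v i with hN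
  -- As P - Q ≥ 1, passing to the remainder changes N by a multiple of f_j.
  suffices h : IsCoprime N (f j) by
    obtain ⟨e, he⟩ : ∃ e, p ^ s - p ^ (s - 1) = e + 1 := ⟨_, (Nat.sub_add_cancel (by omega)).symm⟩
    rw [he]
    have h1 := modByMonic_add_div N (f j ^ (e + 1))
    have h2 : N %ₘ f j ^ (e + 1) = N + f j * (-(f j ^ e * (N /ₘ f j ^ (e + 1)))) := by
      rw [pow_succ] at h1 ⊢
      linear_combination h1
    rw [h2]
    exact IsCoprime.add_mul_left_left h _
  have hprod : IsCoprime (∏ i ∈ Finset.univ.erase j, f i) (f j) :=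
    IsCoprime.prod_left fun i hi => hfcop (Finset.ne_of_mem_erase hi)
  have hbin : IsCoprime (binomSum p s n α₀ z) (f j) :=
    isCoprime_binomSum hp hs hpR hα hz (hfprod ▸ Finset.dvd_prod_of_mem f (Finset.mem_univ j))
  have hw : IsCoprime (if (j : ℕ) + 1 < r then w j else 1) (f j) := by
    split_ifs with hj
    · refine ⟨∏ i ∈ Finset.Ioi j, f i ^ p ^ s, v j * f j ^ (p ^ s - 1), ?_⟩
      rw [mul_assoc, ← pow_succ, Nat.sub_add_cancel (Nat.pos_of_ne_zero hps), ← hvw j hj]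
      ring
    · exact isCoprime_one_left
  refine ((hprod.pow_left.mul_left hbin).mul_left hw).mul_left
    (IsCoprime.prod_left fun i hi => ?_)
  rw [Finset.mem_Iio, Fin.lt_def] at hi
  -- Since i < j, the product in the Bézout relation for i contains a power of f_j, which is split
  -- off.
  refine ⟨f i ^ p ^ s, w i * (∏ l ∈ (Finset.Ioi i).erase j, f l ^ p ^ s) * f j ^ (p ^ s - 1), ?_⟩
  rw [mul_assoc, ← pow_succ, Nat.sub_add_cancel (Nat.pos_of_ne_zero hps), mul_assoc,
    Finset.prod_erase_mul _ _ (Finset.mem_Ioi.2 (Fin.lt_def.2 hi)), ← hvw i (by omega)]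
  ring

end UnitM
-- Orthogonal complements as spans of twisted generators
section Orth

variable {R : Type*} [CommRing R] {γ : R} {k g M : R[X]} {P Q : ℕ}

theorem orth_mul_pow (hk : k.Monic) (hX : IsUnit (toK k X))
    (h : IsNilExt (toK k (C γ)) (toK k g) (toK k M) P Q) {τ : ℕ} (hτ : τ ≤ P) :
    orth k (Ideal.span {toK k (C γ * g ^ τ)}) =
      Ideal.span {toKhat k g.reverse ^ (P - τ), toKhat k (C γ)} := by
  rw [orth_eq_map hk hX, toKhat_reverse_pow hk, toKhat_C_eq_twist hk, span_twist_pair,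
    map_mul, map_pow, h.annihilator_mul_pow hτ]

theorem orth_bot (hk : k.Monic) (hX : IsUnit (toK k X)) :
    orth k (⊥ : Ideal (K k)) = Set.univ := by
  rw [orth_eq_map hk hX, Submodule.annihilator_bot, Ideal.map_top]
  rfl

theorem orth_top (hk : k.Monic) (hX : IsUnit (toK k X)) :
    orth k (⊤ : Ideal (K k)) = {0} := by
  have h : Submodule.annihilator (⊤ : Ideal (K k)) = ⊥ := by
    rw [eq_bot_iff]
    intro a ha
    rw [Submodule.mem_annihilator] at ha
    simpa using ha 1 trivial
  rw [orth_eq_map hk hX, h, Ideal.map_bot]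
  rfl

theorem ideal3_eq (ω t : ℕ) (G : R[X]) : ideal3 γ k g ω t G =
    Ideal.span {toK k g ^ ω + toK k (C γ) * toK k g ^ t * toK k G} := by
  simp only [ideal3, map_add, map_mul, map_pow]

theorem ideal4_eq (ω t : ℕ) (G : R[X]) (μ : ℕ) : ideal4 γ k g ω t G μ =
    Ideal.span {toK k g ^ ω + toK k (C γ) * toK k g ^ t * toK k G,
      toK k (C γ) * toK k g ^ μ} := by
  simp only [ideal4, map_add, map_mul, map_pow]

theorem C_mul_reverse_pow (hk : k.Monic) (n : ℕ) :
    toKhat k (C γ) * toKhat k g.reverse ^ n =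
      twist hk (g.natDegree * n) (toK k (C γ) * toK k g ^ n) := by
  rw [toKhat_C_eq_twist hk, toKhat_reverse_pow hk, twist_mul, zero_add]

theorem C_mul_xStar (hk : k.Monic) {e N : ℤ} (h : e = N) (H : R[X]) :
    toKhat k (C γ) * xStar k e H = twist hk N (toK k (C γ) * toK k H) := by
  rw [toKhat_C_eq_twist hk, xStar_eq_twist hk, twist_mul, zero_add, h]

theorem C_mul_xStar_mul_pow (hk : k.Monic) {e N : ℤ} {n : ℕ} (h : e + g.natDegree * n = N)
    (H : R[X]) : toKhat k (C γ) * xStar k e H * toKhat k g.reverse ^ n =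
      twist hk N (toK k (C γ) * toK k H * toK k g ^ n) := by
  rw [toKhat_C_eq_twist hk, xStar_eq_twist hk, toKhat_reverse_pow hk, twist_mul, twist_mul,
    zero_add, h]

/-- `hU` is pure algebra in the quotient and `hE` is bookkeeping of powers of x; each case of the
theorem reduces to these two checks. -/
theorem orth_ideal3_of_pow (hk : k.Monic) (hX : IsUnit (toK k X))
    (h : IsNilExt (toK k (C γ)) (toK k g) (toK k M) P Q) {ω t : ℕ} {G : R[X]} (hω : ω ≤ P)
    (U : K k) (hU : toK k (C γ) * (toK k g ^ Q * toK k M - toK k g ^ (t + P - ω) * toK k G) =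
      toK k (C γ) * toK k g ^ ω * U) {E : Khat k}
    (hE : E = twist hk (g.natDegree * (P - ω : ℕ)) (toK k g ^ (P - ω) + toK k (C γ) * U)) :
    orth k (ideal3 γ k g ω t G) = Ideal.span {E} := by
  rw [orth_eq_map hk hX, ideal3_eq, h.annihilator_of_pow hω hU, hE, span_twist]

theorem orth_ideal3_of_unit (hk : k.Monic) (hX : IsUnit (toK k X))
    (h : IsNilExt (toK k (C γ)) (toK k g) (toK k M) P Q) {ω κ t : ℕ} {G : R[X]} (hω : ω ≤ P)
    (hκ : κ ≤ ω) {U : K k} (hu : IsUnit U)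
    (hU : toK k (C γ) * (toK k g ^ Q * toK k M - toK k g ^ (t + P - ω) * toK k G) =
      toK k (C γ) * toK k g ^ κ * U) {E : Khat k}
    (hE : E = twist hk (g.natDegree * (P - κ : ℕ)) (toK k g ^ (P - κ) + toK k (C γ) * U)) :
    orth k (ideal3 γ k g ω t G) =
      Ideal.span {E, toKhat k (C γ) * toKhat k g.reverse ^ (P - ω)} := by
  rw [orth_eq_map hk hX, ideal3_eq, h.annihilator_of_unit hω hκ hU hu, hE, C_mul_reverse_pow hk,
    span_twist_pair]

theorem orth_ideal4 (hk : k.Monic) (hX : IsUnit (toK k X))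
    (h : IsNilExt (toK k (C γ)) (toK k g) (toK k M) P Q) {ω μ t : ℕ} {G : R[X]} (hω : ω ≤ P)
    (hμ : μ ≤ ω) (U : K k)
    (hU : toK k (C γ) * (toK k g ^ Q * toK k M - toK k g ^ (t + P - ω) * toK k G) =
      toK k (C γ) * toK k g ^ μ * U) {E : Khat k}
    (hE : E = twist hk (g.natDegree * (P - μ : ℕ)) (toK k g ^ (P - μ) + toK k (C γ) * U)) :
    orth k (ideal4 γ k g ω t G μ) =
      Ideal.span {E, toKhat k (C γ) * toKhat k g.reverse ^ (P - ω)} := by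
  rw [orth_eq_map hk hX, ideal4_eq, h.annihilator_pair hω hμ hU, hE, C_mul_reverse_pow hk,
    span_twist_pair]

theorem IsKappa.le_of_unit (h : IsNilExt (toK k (C γ)) (toK k g) (toK k M) P Q) {ω κ t e : ℕ}
    {G : R[X]} (hκ : IsKappa γ k g ω t G κ) (hω : ω ≤ P) {U : K k} (hu : IsUnit U)
    (hU : toK k (C γ) * (toK k g ^ Q * toK k M - toK k g ^ (t + P - ω) * toK k G) =
      toK k (C γ) * toK k g ^ e * U) : κ ≤ e := by
  refine hκ.2 ?_
  change toK k (C γ * g ^ e) ∈ ideal3 γ k g ω t G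
  rw [ideal3_eq, map_mul, map_pow]
  exact h.mul_pow_mem hω hU hu

theorem IsCoeff.isUnit {ζ : R} {t l : ℕ} {G : R[X]} (h : IsCoeff ζ k g t l G) (hG : G ≠ 0) :
    IsUnit (toK k G) := (h.resolve_left hG).2.1

theorem IsDecomp.isUnit {δ : ℕ} {G A : R[X]} (h : IsDecomp γ k g P M G δ A) (hA : A ≠ 0) :
    IsUnit (toK k A) := h.2.1.resolve_left hA

theorem IsDecomp.mul_pow_eq {δ : ℕ} {G A : R[X]} (h : IsDecomp γ k g P M G δ A) (n : ℕ) :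
    toK k (C γ) * (toK k g ^ n * toK k M - toK k g ^ n * toK k G) =
      toK k (C γ) * toK k g ^ (n + δ) * toK k A := by
  have h2 := h.2.2
  simp only [map_mul, map_sub, map_pow] at h2
  rw [pow_add]
  linear_combination toK k g ^ n * h2

theorem IsDecomp.mul_pow_eq_zero (hs : IsNilExt (toK k (C γ)) (toK k g) (toK k M) P Q) {δ : ℕ}
    {G A : R[X]} (h : IsDecomp γ k g P M G δ A) {n : ℕ} (hA : A = 0 ∨ P ≤ n + δ) :
    toK k (C γ) * (toK k g ^ n * toK k M - toK k g ^ n * toK k G) = 0 := by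
  rw [h.mul_pow_eq]
  rcases hA with rfl | hA
  · rw [map_zero, mul_zero]
  · rw [hs.mul_pow_eq_zero hA, zero_mul]

theorem IsDecomp.span_eq (hs : IsNilExt (toK k (C γ)) (toK k g) (toK k M) P Q) {δ ω t : ℕ}
    {G A : R[X]} (h : IsDecomp γ k g P M G δ A) (hA : A = 0 ∨ ω ≤ t + δ) :
    Ideal.span {toK k g ^ ω + toK k (C γ) * toK k g ^ t * toK k G} =
      Ideal.span {toK k g ^ ω + toK k (C γ) * toK k g ^ t * toK k M} := by
  have h2 := h.mul_pow_eq t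
  rcases hA with rfl | hA
  · refine hs.span_congr (B := 0) ?_
    rw [map_zero] at h2
    linear_combination h2
  · obtain ⟨e, he⟩ := Nat.exists_eq_add_of_le hA
    refine hs.span_congr (B := toK k g ^ e * toK k A) ?_
    rw [he, pow_add] at h2
    linear_combination h2

end Orth

theorem pow_split {A : Type*} [CommRing A] (x : A) {a b c : ℕ} (h : a = b + c) :
    x ^ a = x ^ b * x ^ c := by rw [h, pow_add]

theorem isUnit_of_mem_teich {R : Type*} [CommRing R] {ζ a : R} (hζ : orderOf ζ ≠ 0)
    (ha : a ∈ teich ζ) (ha0 : a ≠ 0) : IsUnit a := by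
  obtain rfl | ⟨i, rfl⟩ := ha
  · exact absurd rfl ha0
  · exact (IsUnit.of_pow_eq_one (pow_orderOf_eq_one ζ) hζ).pow i

/-! ### Case analysis for Types III and IV -/

section Cases

variable {R : Type*} [CommRing R] {γ : R} {k g M : R[X]} {P Q : ℕ}

theorem reverse_pow_eq_twist (hk : k.Monic) (n : ℕ) :
    toKhat k g.reverse ^ n =
      twist hk (g.natDegree * n) (toK k g ^ n + toK k (C γ) * 0) := by
  rw [mul_zero, add_zero, toKhat_reverse_pow hk]

theorem orth_typeIII_charP (hk : k.Monic) (hX : IsUnit (toK k X))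
    (h : IsNilExt (toK k (C γ)) (toK k g) (toK k 0) P Q) {ζ : R} {ω t : ℕ} {G : R[X]}
    (hT : IsType3 γ ζ k g P ω t G) :
    (G = 0 → orth k (ideal3 γ k g ω t G) =
      Ideal.span {toKhat k g.reverse ^ (P - ω)}) ∧
    (G ≠ 0 → 2 * ω ≤ P + t → orth k (ideal3 γ k g ω t G) =
      Ideal.span {toKhat k g.reverse ^ (P - ω) -
        toKhat k (C γ) * xStar k ((g.natDegree : ℤ) * ω - g.natDegree * t) G *
          toKhat k g.reverse ^ (P + t - 2 * ω)}) ∧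
    (G ≠ 0 → P + t < 2 * ω → orth k (ideal3 γ k g ω t G) =
      Ideal.span {toKhat k g.reverse ^ (ω - t) -
        toKhat k (C γ) * xStar k ((g.natDegree : ℤ) * ω - g.natDegree * t) G,
        toKhat k (C γ) * toKhat k g.reverse ^ (P - ω)}) := by
  obtain ⟨hω0, hωP, κ, hκ, hκω, hG⟩ := hT
  refine ⟨?_, ?_, ?_⟩
  · rintro rfl
    refine orth_ideal3_of_pow hk hX h hωP.le 0 ?_ (reverse_pow_eq_twist hk _)
    simp only [map_zero, mul_zero, sub_zero]
  · intro hG0 hc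
    refine orth_ideal3_of_pow hk hX h hωP.le (-(toK k g ^ (P + t - 2 * ω) * toK k G)) ?_ ?_
    · rw [pow_split (toK k g) (show t + P - ω = ω + (P + t - 2 * ω) by omega), map_zero]
      ring
    · have h1 : (ω : ℤ) - t + ((P + t - 2 * ω : ℕ) : ℤ) = ((P - ω : ℕ) : ℤ) := by omega
      rw [C_mul_xStar_mul_pow hk (N := g.natDegree * (P - ω : ℕ))
        (by linear_combination (g.natDegree : ℤ) * h1),
        toKhat_reverse_pow hk, twist_sub]
      congr 1; ring
  · intro hG0 hc
    have e1 : P - (t + P - ω) = ω - t := by omega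
    refine orth_ideal3_of_unit hk hX h hωP.le (κ := t + P - ω) (by omega)
      (hG.isUnit hG0).neg ?_ ?_
    · rw [map_zero]; ring
    · have h1 : (ω : ℤ) - t = ((ω - t : ℕ) : ℤ) := by omega
      rw [e1, C_mul_xStar hk (N := g.natDegree * (ω - t : ℕ))
        (by linear_combination (g.natDegree : ℤ) * h1),
        toKhat_reverse_pow hk, twist_sub]
      congr 1; ring

theorem orth_typeIV_charP (hk : k.Monic) (hX : IsUnit (toK k X))
    (h : IsNilExt (toK k (C γ)) (toK k g) (toK k 0) P Q) {ζ : R} {ω t μ : ℕ} {G : R[X]}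
    (hT : IsType4 γ ζ k g P ω t G μ) :
    (G = 0 → orth k (ideal4 γ k g ω t G μ) =
      Ideal.span {toKhat k g.reverse ^ (P - μ),
        toKhat k (C γ) * toKhat k g.reverse ^ (P - ω)}) ∧
    (G ≠ 0 → orth k (ideal4 γ k g ω t G μ) =
      Ideal.span {toKhat k g.reverse ^ (P - μ) -
        toKhat k (C γ) * xStar k ((g.natDegree : ℤ) * ω - g.natDegree * t) G *
          toKhat k g.reverse ^ (P + t - μ - ω),
        toKhat k (C γ) * toKhat k g.reverse ^ (P - ω)}) := by
  obtain ⟨hωP, κ, hκ, hμκ, hκω, hG⟩ := hT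
  refine ⟨?_, ?_⟩
  · rintro rfl
    refine orth_ideal4 hk hX h hωP.le (by omega) 0 ?_ (reverse_pow_eq_twist hk _)
    simp only [map_zero, mul_zero, sub_zero]
  · intro hG0
    -- With M = 0 the unit cofactor is -G. Together with μ < κ this keeps the exponent P + t - μ - ω
    -- from truncating.
    have hκt : κ ≤ t + P - ω := hκ.le_of_unit h hωP.le (hG.isUnit hG0).neg (by
      rw [map_zero]; ring)
    refine orth_ideal4 hk hX h hωP.le (by omega)
      (-(toK k g ^ (P + t - μ - ω) * toK k G)) ?_ ?_
    · rw [pow_split (toK k g) (show t + P - ω = μ + (P + t - μ - ω) by omega), map_zero]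
      ring
    · have h1 : (ω : ℤ) - t + ((P + t - μ - ω : ℕ) : ℤ) = ((P - μ : ℕ) : ℤ) := by omega
      rw [C_mul_xStar_mul_pow hk (N := g.natDegree * (P - μ : ℕ))
        (by linear_combination (g.natDegree : ℤ) * h1),
        toKhat_reverse_pow hk, twist_sub]
      congr 1; ring

/-- The smaller exponent is factored out; when M is a unit, so is the cofactor, which differs from M
by a multiple of a positive power of the nilpotent f. -/
theorem sub_eq_of_lt {ω t : ℕ} {G : R[X]} (hc : ω + Q < P + t) :
    toK k (C γ) * (toK k g ^ Q * toK k M - toK k g ^ (t + P - ω) * toK k G) =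
      toK k (C γ) * toK k g ^ Q * (toK k M + toK k g ^ (P + t - ω - Q) * -toK k G) := by
  rw [pow_split (toK k g) (show t + P - ω = Q + (P + t - ω - Q) by omega)]
  ring

theorem sub_eq_of_gt {ω t : ℕ} {G : R[X]} (hω : ω ≤ P) (hc : P + t < ω + Q) :
    toK k (C γ) * (toK k g ^ Q * toK k M - toK k g ^ (t + P - ω) * toK k G) =
      toK k (C γ) * toK k g ^ (t + P - ω) *
        (-toK k G + toK k g ^ (Q + ω - t - P) * toK k M) := by
  rw [pow_split (toK k g) (show Q = (t + P - ω) + (Q + ω - t - P) by omega)]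
  ring

theorem sub_eq_of_le {ω t e : ℕ} {G : R[X]} (heQ : e ≤ Q) (he : e + ω ≤ P + t) :
    toK k (C γ) * (toK k g ^ Q * toK k M - toK k g ^ (t + P - ω) * toK k G) =
      toK k (C γ) * toK k g ^ e *
        (toK k g ^ (Q - e) * toK k M - toK k g ^ (P + t - e - ω) * toK k G) := by
  have h1 : toK k g ^ Q = _ := pow_split (toK k g) (show Q = e + (Q - e) by omega)
  rw [h1, pow_split (toK k g) (show t + P - ω = e + (P + t - e - ω) by omega)]
  ring

theorem sub_zero_eq_of_le {n e : ℕ} (heQ : e ≤ Q) :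
    toK k (C γ) * (toK k g ^ Q * toK k M - toK k g ^ n * toK k 0) =
      toK k (C γ) * toK k g ^ e * (toK k g ^ (Q - e) * toK k M) := by
  have h1 : toK k g ^ Q = _ := pow_split (toK k g) (show Q = e + (Q - e) by omega)
  rw [map_zero, h1]
  ring

/-- All three summands carry the same power d (P - e) of x; the hypotheses keep the natural-number
subtractions from truncating. -/
theorem twist_sub_eq (hk : k.Monic) {ω t e : ℕ} {G : R[X]} (hQP : Q ≤ P) (heQ : e ≤ Q)
    (he : e + ω ≤ P + t) :
    toKhat k g.reverse ^ (P - e) +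
      toKhat k (C γ) * xStar k ((g.natDegree : ℤ) * P - g.natDegree * Q) M *
        toKhat k g.reverse ^ (Q - e) -
      toKhat k (C γ) * xStar k ((g.natDegree : ℤ) * ω - g.natDegree * t) G *
        toKhat k g.reverse ^ (P + t - e - ω) =
    twist hk (g.natDegree * (P - e : ℕ)) (toK k g ^ (P - e) + toK k (C γ) *
      (toK k g ^ (Q - e) * toK k M - toK k g ^ (P + t - e - ω) * toK k G)) := by
  have h1 : (P : ℤ) - Q + ((Q - e : ℕ) : ℤ) = ((P - e : ℕ) : ℤ) := by omega
  have h2 : (ω : ℤ) - t + ((P + t - e - ω : ℕ) : ℤ) = ((P - e : ℕ) : ℤ) := by omega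
  rw [C_mul_xStar_mul_pow hk (n := Q - e) (N := g.natDegree * (P - e : ℕ))
        (by linear_combination (g.natDegree : ℤ) * h1),
    C_mul_xStar_mul_pow hk (n := P + t - e - ω) (N := g.natDegree * (P - e : ℕ))
        (by linear_combination (g.natDegree : ℤ) * h2),
    toKhat_reverse_pow hk, twist_add, twist_sub]
  congr 1; ring

theorem twist_add_eq (hk : k.Monic) {e : ℕ} (hQP : Q ≤ P) (heQ : e ≤ Q) :
    toKhat k g.reverse ^ (P - e) +
      toKhat k (C γ) * xStar k ((g.natDegree : ℤ) * P - g.natDegree * Q) M *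
        toKhat k g.reverse ^ (Q - e) =
    twist hk (g.natDegree * (P - e : ℕ)) (toK k g ^ (P - e) + toK k (C γ) *
      (toK k g ^ (Q - e) * toK k M)) := by
  have h1 : (P : ℤ) - Q + ((Q - e : ℕ) : ℤ) = ((P - e : ℕ) : ℤ) := by omega
  rw [C_mul_xStar_mul_pow hk (N := g.natDegree * (P - e : ℕ))
        (by linear_combination (g.natDegree : ℤ) * h1),
    toKhat_reverse_pow hk, twist_add]
  congr 1; ring

theorem twist_decomp_eq (hk : k.Monic) {e δ : ℕ} {A : R[X]} (hδ : δ < P - Q) (he : e ≤ Q + δ) :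
    toKhat k g.reverse ^ (P - e) +
      toKhat k (C γ) * xStar k ((g.natDegree : ℤ) * P - g.natDegree * Q - g.natDegree * δ) A *
        toKhat k g.reverse ^ (Q + δ - e) =
    twist hk (g.natDegree * (P - e : ℕ)) (toK k g ^ (P - e) + toK k (C γ) *
      (toK k g ^ (Q + δ - e) * toK k A)) := by
  have h1 : (P : ℤ) - Q - δ + ((Q + δ - e : ℕ) : ℤ) = ((P - e : ℕ) : ℤ) := by omega
  rw [C_mul_xStar_mul_pow hk (N := g.natDegree * (P - e : ℕ))
        (by linear_combination (g.natDegree : ℤ) * h1),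
    toKhat_reverse_pow hk, twist_add]
  congr 1; ring

theorem orth_typeIII_charPSq (hk : k.Monic) (hX : IsUnit (toK k X))
    (h : IsNilExt (toK k (C γ)) (toK k g) (toK k M) P Q) (hM : IsUnit (toK k M)) (hQP : Q < P)
    {ζ : R} {ω t δ : ℕ} {G A : R[X]} (hT : IsType3 γ ζ k g P ω t G)
    (hD : IsDecomp γ k g P M G δ A) :
    (G ≠ 0 → ω + Q = P + t → (A = 0 ∨ (A ≠ 0 ∧ P - Q ≤ δ)) →
      ideal3 γ k g ω t G = ideal3 γ k g ω (ω + Q - P) M) ∧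
    (G = 0 → ω ≤ Q → orth k (ideal3 γ k g ω t G) =
      Ideal.span {toKhat k g.reverse ^ (P - ω) +
        toKhat k (C γ) * xStar k ((g.natDegree : ℤ) * P - g.natDegree * Q) M * toKhat k g.reverse ^ (Q - ω)}) ∧
    (G = 0 → Q < ω → orth k (ideal3 γ k g ω t G) =
      Ideal.span {toKhat k g.reverse ^ (P - Q) +
        toKhat k (C γ) * xStar k ((g.natDegree : ℤ) * P - g.natDegree * Q) M,
        toKhat k (C γ) * toKhat k g.reverse ^ (P - ω)}) ∧
    (G ≠ 0 → ω + Q < P + t → Q < ω → orth k (ideal3 γ k g ω t G) =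
      Ideal.span {toKhat k g.reverse ^ (P - Q) +
        toKhat k (C γ) * xStar k ((g.natDegree : ℤ) * P - g.natDegree * Q) M -
        toKhat k (C γ) * xStar k ((g.natDegree : ℤ) * ω - g.natDegree * t) G *
          toKhat k g.reverse ^ (P + t - ω - Q),
        toKhat k (C γ) * toKhat k g.reverse ^ (P - ω)}) ∧
    (G ≠ 0 → ω + Q < P + t → ω ≤ Q → orth k (ideal3 γ k g ω t G) =
      Ideal.span {toKhat k g.reverse ^ (P - ω) +
        toKhat k (C γ) * xStar k ((g.natDegree : ℤ) * P - g.natDegree * Q) M * toKhat k g.reverse ^ (Q - ω) -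
        toKhat k (C γ) * xStar k ((g.natDegree : ℤ) * ω - g.natDegree * t) G *
          toKhat k g.reverse ^ (P + t - 2 * ω)}) ∧
    (G ≠ 0 → P + t < ω + Q → 2 * ω ≤ P + t → orth k (ideal3 γ k g ω t G) =
      Ideal.span {toKhat k g.reverse ^ (P - ω) +
        toKhat k (C γ) * xStar k ((g.natDegree : ℤ) * P - g.natDegree * Q) M * toKhat k g.reverse ^ (Q - ω) -
        toKhat k (C γ) * xStar k ((g.natDegree : ℤ) * ω - g.natDegree * t) G *
          toKhat k g.reverse ^ (P + t - 2 * ω)}) ∧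
    (G ≠ 0 → P + t < ω + Q → P + t < 2 * ω → orth k (ideal3 γ k g ω t G) =
      Ideal.span {toKhat k g.reverse ^ (ω - t) +
        toKhat k (C γ) * xStar k ((g.natDegree : ℤ) * P - g.natDegree * Q) M *
          toKhat k g.reverse ^ (Q + ω - t - P) -
        toKhat k (C γ) * xStar k ((g.natDegree : ℤ) * ω - g.natDegree * t) G,
        toKhat k (C γ) * toKhat k g.reverse ^ (P - ω)}) ∧
    (G ≠ 0 → ω + Q = P + t → (A = 0 ∨ (A ≠ 0 ∧ P - Q ≤ δ)) →
      orth k (ideal3 γ k g ω t G) = Ideal.span {toKhat k g.reverse ^ (P - ω)}) ∧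
    (G ≠ 0 → ω + Q = P + t → A ≠ 0 → ω ≤ Q + δ → δ < P - Q →
      orth k (ideal3 γ k g ω t G) =
      Ideal.span {toKhat k g.reverse ^ (P - ω) +
        toKhat k (C γ) * xStar k ((g.natDegree : ℤ) * P - g.natDegree * Q - g.natDegree * δ) A *
          toKhat k g.reverse ^ (Q + δ - ω)}) ∧
    (G ≠ 0 → ω + Q = P + t → A ≠ 0 → Q + δ < ω →
      orth k (ideal3 γ k g ω t G) =
      Ideal.span {toKhat k g.reverse ^ (P - Q - δ) +
        toKhat k (C γ) * xStar k ((g.natDegree : ℤ) * P - g.natDegree * Q - g.natDegree * δ) A,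
        toKhat k (C γ) * toKhat k g.reverse ^ (P - ω)}) := by
  obtain ⟨hω0, hωP, κ, hκ, hκω, hG⟩ := hT
  refine ⟨?_, ?_, ?_, ?_, ?_, ?_, ?_, ?_, ?_, ?_⟩
  · intro hG0 hc hA
    obtain rfl : t = ω + Q - P := by omega
    rw [ideal3_eq, ideal3_eq]
    exact hD.span_eq h (hA.imp_right fun hA => by omega)
  · rintro rfl hc
    exact orth_ideal3_of_pow hk hX h hωP.le _ (sub_zero_eq_of_le hc) (twist_add_eq hk hQP.le hc)
  · rintro rfl hc
    refine orth_ideal3_of_unit hk hX h hωP.le hc.le hM (by rw [map_zero]; ring) ?_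
    simpa using twist_add_eq (γ := γ) (g := g) (M := M) hk hQP.le (le_refl Q)
  · intro hG0 hc hc'
    refine orth_ideal3_of_unit hk hX h hωP.le hc'.le
      (h.isUnit_add_pow_mul hM (by omega) _) (sub_eq_of_lt hc) ?_
    have h1 := twist_sub_eq (γ := γ) (g := g) (M := M) (G := G) hk hQP.le (le_refl Q)
      (show Q + ω ≤ P + t by omega)
    rw [Nat.sub_right_comm (P + t) Q ω] at h1
    simp only [Nat.sub_self, pow_zero, mul_one, one_mul] at h1
    rw [h1]
    congr 1; ring
  · intro hG0 hc hc'
    rw [show P + t - 2 * ω = P + t - ω - ω by omega]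
    exact orth_ideal3_of_pow hk hX h hωP.le _ (sub_eq_of_le hc' (by omega))
      (twist_sub_eq hk hQP.le hc' (by omega))
  · intro hG0 hc hc'
    rw [show P + t - 2 * ω = P + t - ω - ω by omega]
    exact orth_ideal3_of_pow hk hX h hωP.le _ (sub_eq_of_le (by omega) (by omega))
      (twist_sub_eq hk hQP.le (by omega) (by omega))
  · intro hG0 hc hc'
    refine orth_ideal3_of_unit hk hX h hωP.le (κ := t + P - ω) (by omega)
      (h.isUnit_add_pow_mul (hG.isUnit hG0).neg (by omega) _) (sub_eq_of_gt hωP.le hc) ?_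
    have h1 := twist_sub_eq (γ := γ) (g := g) (M := M) (G := G) hk hQP.le
      (show t + P - ω ≤ Q by omega) (show t + P - ω + ω ≤ P + t by omega)
    have e1 : P - (t + P - ω) = ω - t := by omega
    have e2 : Q - (t + P - ω) = Q + ω - t - P := by omega
    have e3 : P + t - (t + P - ω) - ω = 0 := by omega
    rw [e1, e2, e3] at h1
    simp only [pow_zero, mul_one, one_mul] at h1
    rw [h1, e1]
    congr 1; ring
  · intro hG0 hc hA
    refine orth_ideal3_of_pow hk hX h hωP.le 0 ?_ (reverse_pow_eq_twist hk _)
    rw [show t + P - ω = Q by omega, mul_zero]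
    exact hD.mul_pow_eq_zero h (hA.imp_right fun hA => by omega)
  · intro hG0 hc hA hc' hδ
    refine orth_ideal3_of_pow hk hX h hωP.le _ ?_ (twist_decomp_eq hk hδ hc')
    rw [show t + P - ω = Q by omega, hD.mul_pow_eq, mul_assoc _ (toK k g ^ ω), ← mul_assoc (_ ^ ω),
      ← pow_add, Nat.add_sub_cancel' hc', mul_assoc]
  · intro hG0 hc hA hc'
    refine orth_ideal3_of_unit hk hX h hωP.le hc'.le (hD.isUnit hA) ?_ ?_
    · rw [show t + P - ω = Q by omega, hD.mul_pow_eq]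
    · simpa [Nat.sub_sub] using twist_decomp_eq (γ := γ) (g := g) (A := A) hk
        (show δ < P - Q by omega) (le_refl (Q + δ))

theorem orth_typeIV_charPSq (hk : k.Monic) (hX : IsUnit (toK k X))
    (h : IsNilExt (toK k (C γ)) (toK k g) (toK k M) P Q) (hM : IsUnit (toK k M)) (hQP : Q < P)
    {ζ : R} {ω t μ δ : ℕ} {G A : R[X]} (hT : IsType4 γ ζ k g P ω t G μ)
    (hD : IsDecomp γ k g P M G δ A) :
    (G ≠ 0 → ω + Q = P + t → (A = 0 ∨ (A ≠ 0 ∧ P - Q ≤ δ)) →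
      ideal4 γ k g ω t G μ = ideal4 γ k g ω (ω + Q - P) M μ) ∧
    (G = 0 → P + μ ≤ ω + Q → orth k (ideal4 γ k g ω t G μ) =
      Ideal.span {toKhat k g.reverse ^ (P - μ),
        toKhat k (C γ) * toKhat k g.reverse ^ (P - ω)}) ∧
    (G = 0 → ω + Q < P + μ → orth k (ideal4 γ k g ω t G μ) =
      Ideal.span {toKhat k g.reverse ^ (P - μ) +
        toKhat k (C γ) * xStar k ((g.natDegree : ℤ) * P - g.natDegree * Q) M * toKhat k g.reverse ^ (Q - μ),
        toKhat k (C γ) * toKhat k g.reverse ^ (P - ω)}) ∧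
    (G ≠ 0 → ω + Q ≠ P + t → orth k (ideal4 γ k g ω t G μ) =
      Ideal.span {toKhat k g.reverse ^ (P - μ) +
        toKhat k (C γ) * xStar k ((g.natDegree : ℤ) * P - g.natDegree * Q) M * toKhat k g.reverse ^ (Q - μ) -
        toKhat k (C γ) * xStar k ((g.natDegree : ℤ) * ω - g.natDegree * t) G *
          toKhat k g.reverse ^ (P + t - μ - ω),
        toKhat k (C γ) * toKhat k g.reverse ^ (P - ω)}) ∧
    (G ≠ 0 → ω + Q = P + t → (A = 0 ∨ (A ≠ 0 ∧ P - Q ≤ δ)) →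
      orth k (ideal4 γ k g ω t G μ) =
      Ideal.span {toKhat k g.reverse ^ (P - μ),
        toKhat k (C γ) * toKhat k g.reverse ^ (P - ω)}) ∧
    (G ≠ 0 → ω + Q = P + t → A ≠ 0 → δ < P - Q →
      orth k (ideal4 γ k g ω t G μ) =
      Ideal.span {toKhat k g.reverse ^ (P - μ) +
        toKhat k (C γ) * xStar k ((g.natDegree : ℤ) * P - g.natDegree * Q - g.natDegree * δ) A *
          toKhat k g.reverse ^ (Q + δ - μ),
        toKhat k (C γ) * toKhat k g.reverse ^ (P - ω)}) := by
  obtain ⟨hωP, κ, hκ, hμκ, hκω, hG⟩ := hT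
  have hμω : μ ≤ ω := by omega
  refine ⟨?_, ?_, ?_, ?_, ?_, ?_⟩
  · intro hG0 hc hA
    obtain rfl : t = ω + Q - P := by omega
    rw [ideal4_eq, ideal4_eq, Ideal.span_insert, Ideal.span_insert,
      hD.span_eq h (hA.imp_right fun hA => by omega)]
  · rintro rfl hc
    -- The M-term is a multiple of the second generator γ h^(P-ω), so it can be dropped.
    have e1 : Q - μ = (P - ω) + (Q + ω - P - μ) := by omega
    rw [orth_ideal4 hk hX h hωP.le hμω _ (sub_zero_eq_of_le (by omega))
      (twist_add_eq hk hQP.le (by omega)), e1, pow_add,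
      ← Ideal.span_pair_add_mul_right (toKhat k g.reverse ^ (P - μ))
        (toKhat k (C γ) * toKhat k g.reverse ^ (P - ω))
        (xStar k ((g.natDegree : ℤ) * P - g.natDegree * Q) M *
          toKhat k g.reverse ^ (Q + ω - P - μ))]
    congr 3; ring
  · rintro rfl hc
    have hκQ : κ ≤ Q := hκ.le_of_unit h hωP.le hM (by rw [map_zero]; ring)
    exact orth_ideal4 hk hX h hωP.le hμω _ (sub_zero_eq_of_le (by omega))
      (twist_add_eq hk hQP.le (by omega))
  · intro hG0 hc
    -- κ is at most the smaller of the two exponents, so μ < κ permits factoring f^μ out of both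
    -- terms.
    have hκQ : κ ≤ Q ∧ κ ≤ t + P - ω := by
      rcases hc.lt_or_gt with hc | hc
      · have := hκ.le_of_unit h hωP.le (h.isUnit_add_pow_mul hM (by omega) _) (sub_eq_of_lt hc)
        omega
      · have := hκ.le_of_unit h hωP.le
          (h.isUnit_add_pow_mul (hG.isUnit hG0).neg (by omega) _) (sub_eq_of_gt hωP.le hc)
        omega
    exact orth_ideal4 hk hX h hωP.le hμω _ (sub_eq_of_le (by omega) (by omega))
      (twist_sub_eq hk hQP.le (by omega) (by omega))
  · intro hG0 hc hA
    refine orth_ideal4 hk hX h hωP.le hμω 0 ?_ (reverse_pow_eq_twist hk _)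
    rw [show t + P - ω = Q by omega, mul_zero]
    exact hD.mul_pow_eq_zero h (hA.imp_right fun hA => by omega)
  · intro hG0 hc hA hδ
    have hU : toK k (C γ) * (toK k g ^ Q * toK k M - toK k g ^ (t + P - ω) * toK k G) =
        toK k (C γ) * toK k g ^ (Q + δ) * toK k A := by
      rw [show t + P - ω = Q by omega, hD.mul_pow_eq]
    have hκδ : κ ≤ Q + δ := hκ.le_of_unit h hωP.le (hD.isUnit hA) hU
    refine orth_ideal4 hk hX h hωP.le hμω _ ?_ (twist_decomp_eq hk hδ (by omega))
    rw [hU, mul_assoc _ (toK k g ^ μ), ← mul_assoc (_ ^ μ), ← pow_add,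
      Nat.add_sub_cancel' (by omega), mul_assoc]

end Cases
end ConstaDual

/-! ### The theorem -/

open ConstaDual in
theorem theorem3p4 {R : Type*} [CommRing R] [Finite R] [IsLocalRing R]
    -- `R` is a finite commutative chain ring, `γ` generates its maximal ideal and has
    -- nilpotency index 2, and the residue field has `p ^ m` elements
    (γ : R) (hmax : IsLocalRing.maximalIdeal R = Ideal.span {γ})
    (hγ0 : γ ≠ 0) (hγ2 : γ ^ 2 = 0)
    (p m s n : ℕ) (hp : p.Prime) (hm : 0 < m) (hs : 0 < s) (hn : 0 < n) (hnp : n.Coprime p)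
    (hcard : Nat.card (IsLocalRing.ResidueField R) = p ^ m)
    (ζ : R) (hζ : orderOf ζ = p ^ m - 1)
    (α₀ : R) (hα₀ : α₀ ∈ teich ζ) (hα₀0 : α₀ ≠ 0)
    -- the factorization of `x ^ n - α₀` into monic basic irreducible coprime polynomials
    (r : ℕ) (f : Fin r → R[X]) (hfmonic : ∀ i, (f i).Monic)
    (hfirr : ∀ i, Irreducible ((f i).map (IsLocalRing.residue R)))
    (hfcop : Pairwise fun i l => IsCoprime (f i) (f l))
    (hfprod : ∏ i, f i = X ^ n - C α₀)
    -- the Bézout coefficients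
    (v w : Fin r → R[X])
    (hw : ∀ u : Fin r, (u : ℕ) + 1 < r → (w u).degree < (f u ^ p ^ s).degree)
    (hvw : ∀ u : Fin r, (u : ℕ) + 1 < r →
      v u * f u ^ p ^ s + w u * ∏ i ∈ Finset.Ioi u, f i ^ p ^ s = 1)
    (j : Fin r) (g : R[X]) (hg : g = f j) (d P Q : ℕ) (hd : d = g.natDegree)
    (hP : P = p ^ s) (hQ : Q = p ^ (s - 1)) :
    -- characteristic `p`
    (CharP R p → ∀ k : R[X], k = g ^ P →
      -- zero ideal, whole ring, Type II
      orth k ⊥ = Set.univ ∧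
      orth k ⊤ = {0} ∧
      (∀ τ : ℕ, τ < P → orth k (Ideal.span {toK k (C γ * g ^ τ)}) =
        Ideal.span {toKhat k g.reverse ^ (P - τ), toKhat k (C γ)}) ∧
      -- Type III
      (∀ (ω t : ℕ) (G : R[X]), IsType3 γ ζ k g P ω t G →
        (G = 0 → orth k (ideal3 γ k g ω t G) =
          Ideal.span {toKhat k g.reverse ^ (P - ω)}) ∧
        (G ≠ 0 → 2 * ω ≤ P + t → orth k (ideal3 γ k g ω t G) =
          Ideal.span {toKhat k g.reverse ^ (P - ω) -
            toKhat k (C γ) * xStar k ((d : ℤ) * ω - d * t) G *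
              toKhat k g.reverse ^ (P + t - 2 * ω)}) ∧
        (G ≠ 0 → P + t < 2 * ω → orth k (ideal3 γ k g ω t G) =
          Ideal.span {toKhat k g.reverse ^ (ω - t) -
            toKhat k (C γ) * xStar k ((d : ℤ) * ω - d * t) G,
            toKhat k (C γ) * toKhat k g.reverse ^ (P - ω)})) ∧
      -- Type IV
      (∀ (ω t : ℕ) (G : R[X]) (μ : ℕ), IsType4 γ ζ k g P ω t G μ →
        (G = 0 → orth k (ideal4 γ k g ω t G μ) =
          Ideal.span {toKhat k g.reverse ^ (P - μ),
            toKhat k (C γ) * toKhat k g.reverse ^ (P - ω)}) ∧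
        (G ≠ 0 → orth k (ideal4 γ k g ω t G μ) =
          Ideal.span {toKhat k g.reverse ^ (P - μ) -
            toKhat k (C γ) * xStar k ((d : ℤ) * ω - d * t) G *
              toKhat k g.reverse ^ (P + t - μ - ω),
            toKhat k (C γ) * toKhat k g.reverse ^ (P - ω)}))) ∧
    -- characteristic `p ^ 2`
    (CharP R (p ^ 2) → ∀ z : R, z ∈ teich ζ → z ≠ 0 → (p : R) = γ * z →
      ∀ M k : R[X], M = polyM p s n α₀ z f v w j → k = g ^ P + C γ * g ^ Q * M →
      -- zero ideal, whole ring, Type II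
      orth k ⊥ = Set.univ ∧
      orth k ⊤ = {0} ∧
      (∀ τ : ℕ, τ < P → orth k (Ideal.span {toK k (C γ * g ^ τ)}) =
        Ideal.span {toKhat k g.reverse ^ (P - τ), toKhat k (C γ)}) ∧
      -- Type III
      (∀ (ω t : ℕ) (G : R[X]), IsType3 γ ζ k g P ω t G →
        (∃ (δ : ℕ) (A : R[X]), IsDecomp γ k g P M G δ A) ∧
        ∀ (δ : ℕ) (A : R[X]), IsDecomp γ k g P M G δ A →
        (G ≠ 0 → ω + Q = P + t → (A = 0 ∨ (A ≠ 0 ∧ P - Q ≤ δ)) →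
          ideal3 γ k g ω t G = ideal3 γ k g ω (ω + Q - P) M) ∧
        (G = 0 → ω ≤ Q → orth k (ideal3 γ k g ω t G) =
          Ideal.span {toKhat k g.reverse ^ (P - ω) +
            toKhat k (C γ) * xStar k ((d : ℤ) * P - d * Q) M * toKhat k g.reverse ^ (Q - ω)}) ∧
        (G = 0 → Q < ω → orth k (ideal3 γ k g ω t G) =
          Ideal.span {toKhat k g.reverse ^ (P - Q) +
            toKhat k (C γ) * xStar k ((d : ℤ) * P - d * Q) M,
            toKhat k (C γ) * toKhat k g.reverse ^ (P - ω)}) ∧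
        (G ≠ 0 → ω + Q < P + t → Q < ω → orth k (ideal3 γ k g ω t G) =
          Ideal.span {toKhat k g.reverse ^ (P - Q) +
            toKhat k (C γ) * xStar k ((d : ℤ) * P - d * Q) M -
            toKhat k (C γ) * xStar k ((d : ℤ) * ω - d * t) G *
              toKhat k g.reverse ^ (P + t - ω - Q),
            toKhat k (C γ) * toKhat k g.reverse ^ (P - ω)}) ∧
        (G ≠ 0 → ω + Q < P + t → ω ≤ Q → orth k (ideal3 γ k g ω t G) =
          Ideal.span {toKhat k g.reverse ^ (P - ω) +
            toKhat k (C γ) * xStar k ((d : ℤ) * P - d * Q) M * toKhat k g.reverse ^ (Q - ω) -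
            toKhat k (C γ) * xStar k ((d : ℤ) * ω - d * t) G *
              toKhat k g.reverse ^ (P + t - 2 * ω)}) ∧
        (G ≠ 0 → P + t < ω + Q → 2 * ω ≤ P + t → orth k (ideal3 γ k g ω t G) =
          Ideal.span {toKhat k g.reverse ^ (P - ω) +
            toKhat k (C γ) * xStar k ((d : ℤ) * P - d * Q) M * toKhat k g.reverse ^ (Q - ω) -
            toKhat k (C γ) * xStar k ((d : ℤ) * ω - d * t) G *
              toKhat k g.reverse ^ (P + t - 2 * ω)}) ∧
        (G ≠ 0 → P + t < ω + Q → P + t < 2 * ω → orth k (ideal3 γ k g ω t G) =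
          Ideal.span {toKhat k g.reverse ^ (ω - t) +
            toKhat k (C γ) * xStar k ((d : ℤ) * P - d * Q) M *
              toKhat k g.reverse ^ (Q + ω - t - P) -
            toKhat k (C γ) * xStar k ((d : ℤ) * ω - d * t) G,
            toKhat k (C γ) * toKhat k g.reverse ^ (P - ω)}) ∧
        (G ≠ 0 → ω + Q = P + t → (A = 0 ∨ (A ≠ 0 ∧ P - Q ≤ δ)) →
          orth k (ideal3 γ k g ω t G) = Ideal.span {toKhat k g.reverse ^ (P - ω)}) ∧
        (G ≠ 0 → ω + Q = P + t → A ≠ 0 → ω ≤ Q + δ → δ < P - Q →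
          orth k (ideal3 γ k g ω t G) =
          Ideal.span {toKhat k g.reverse ^ (P - ω) +
            toKhat k (C γ) * xStar k ((d : ℤ) * P - d * Q - d * δ) A *
              toKhat k g.reverse ^ (Q + δ - ω)}) ∧
        (G ≠ 0 → ω + Q = P + t → A ≠ 0 → Q + δ < ω →
          orth k (ideal3 γ k g ω t G) =
          Ideal.span {toKhat k g.reverse ^ (P - Q - δ) +
            toKhat k (C γ) * xStar k ((d : ℤ) * P - d * Q - d * δ) A,
            toKhat k (C γ) * toKhat k g.reverse ^ (P - ω)})) ∧
      -- Type IV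
      (∀ (ω t : ℕ) (G : R[X]) (μ : ℕ), IsType4 γ ζ k g P ω t G μ →
        (∃ (δ : ℕ) (A : R[X]), IsDecomp γ k g P M G δ A) ∧
        ∀ (δ : ℕ) (A : R[X]), IsDecomp γ k g P M G δ A →
        (G ≠ 0 → ω + Q = P + t → (A = 0 ∨ (A ≠ 0 ∧ P - Q ≤ δ)) →
          ideal4 γ k g ω t G μ = ideal4 γ k g ω (ω + Q - P) M μ) ∧
        (G = 0 → P + μ ≤ ω + Q → orth k (ideal4 γ k g ω t G μ) =
          Ideal.span {toKhat k g.reverse ^ (P - μ),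
            toKhat k (C γ) * toKhat k g.reverse ^ (P - ω)}) ∧
        (G = 0 → ω + Q < P + μ → orth k (ideal4 γ k g ω t G μ) =
          Ideal.span {toKhat k g.reverse ^ (P - μ) +
            toKhat k (C γ) * xStar k ((d : ℤ) * P - d * Q) M * toKhat k g.reverse ^ (Q - μ),
            toKhat k (C γ) * toKhat k g.reverse ^ (P - ω)}) ∧
        (G ≠ 0 → ω + Q ≠ P + t → orth k (ideal4 γ k g ω t G μ) =
          Ideal.span {toKhat k g.reverse ^ (P - μ) +
            toKhat k (C γ) * xStar k ((d : ℤ) * P - d * Q) M * toKhat k g.reverse ^ (Q - μ) -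
            toKhat k (C γ) * xStar k ((d : ℤ) * ω - d * t) G *
              toKhat k g.reverse ^ (P + t - μ - ω),
            toKhat k (C γ) * toKhat k g.reverse ^ (P - ω)}) ∧
        (G ≠ 0 → ω + Q = P + t → (A = 0 ∨ (A ≠ 0 ∧ P - Q ≤ δ)) →
          orth k (ideal4 γ k g ω t G μ) =
          Ideal.span {toKhat k g.reverse ^ (P - μ),
            toKhat k (C γ) * toKhat k g.reverse ^ (P - ω)}) ∧
        (G ≠ 0 → ω + Q = P + t → A ≠ 0 → δ < P - Q →
          orth k (ideal4 γ k g ω t G μ) =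
          Ideal.span {toKhat k g.reverse ^ (P - μ) +
            toKhat k (C γ) * xStar k ((d : ℤ) * P - d * Q - d * δ) A *
              toKhat k g.reverse ^ (Q + δ - μ),
            toKhat k (C γ) * toKhat k g.reverse ^ (P - ω)}))) := by
  have hpm : 2 ≤ p ^ m := hp.two_le.trans (Nat.le_self_pow hm.ne' p)
  -- A nonzero `orderOf` means some positive power of ζ is 1, so ζ and all nonzero Teichmüller
  -- elements are units.
  have hζ0 : orderOf ζ ≠ 0 := by omega
  have hα : IsUnit α₀ := isUnit_of_mem_teich hζ0 hα₀ hα₀0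
  have hgm : g.Monic := hg ▸ hfmonic j
  have hgi : Irreducible (g.map (IsLocalRing.residue R)) := hg ▸ hfirr j
  have hP0 : P ≠ 0 := hP ▸ pow_ne_zero _ hp.ne_zero
  have hQP : Q < P := by
    rw [hP, hQ]; exact Nat.pow_lt_pow_right hp.one_lt (by omega)
  have hXg : IsCoprime (X : R[X]) g := by
    obtain ⟨c, hc⟩ : g ∣ X ^ n - C α₀ :=
      hg ▸ hfprod ▸ Finset.dvd_prod_of_mem f (Finset.mem_univ j)
    obtain ⟨a, ha⟩ := hα.exists_left_inv
    -- With a = α₀⁻¹ and g c = x^n - α₀, one has a x^n - a g c = 1.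
    refine ⟨C a * X ^ (n - 1), -(C a * c), ?_⟩
    have h1 : (X : R[X]) ^ (n - 1) * X = X ^ n := by
      rw [← pow_succ, Nat.sub_add_cancel hn]
    have h2 : (C a : R[X]) * C α₀ = 1 := by rw [← C_mul, ha, C_1]
    linear_combination C a * h1 + C a * hc + h2
  have hunit (M k b : R[X]) (hk : k = g ^ P + C γ * g ^ Q * M) (hb : IsCoprime b g) :
      IsUnit (toK k b) :=
    isUnit_toK_of_isCoprime hmax hγ2 hk (hb.map (mapRingHom (IsLocalRing.residue R)))
  subst hd
  constructor
  · intro _ k hk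
    -- Characteristic p is the case M = 0 of the common shape.
    have hk0 : k = g ^ P + C γ * g ^ Q * 0 := by rw [hk, mul_zero, add_zero]
    have hkm : k.Monic := hk ▸ hgm.pow P
    have hX := hunit 0 k X hk0 hXg
    have h := isNilExt_toK hmax hγ0 hγ2 hgm hk0
    exact ⟨orth_bot hkm hX, orth_top hkm hX, fun τ hτ => orth_mul_pow hkm hX h hτ.le,
      fun ω t G hT => orth_typeIII_charP hkm hX h hT,
      fun ω t G μ hT => orth_typeIV_charP hkm hX h hT⟩
  · intro _ z hz hz0 hpz M k hM hk
    have hpR : (p : R) ∈ IsLocalRing.maximalIdeal R := by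
      rw [hmax, hpz]; exact Ideal.mul_mem_right _ _ (Ideal.mem_span_singleton_self γ)
    have hMg : IsCoprime M g := by
      rw [hM, hg]
      exact isCoprime_polyM hp hs hpR hα (isUnit_of_mem_teich hζ0 hz hz0) f v w hfcop hfprod hvw j
    have hkm : k.Monic := by
      refine monic_of_degree_lt hgm hQP.le ?_ hk
      rw [hM, hP, hQ, hg]
      exact degree_modByMonic_lt _ ((hfmonic j).pow _)
    have hX := hunit M k X hk hXg
    have hMu := hunit M k M hk hMg
    have h := isNilExt_toK hmax hγ0 hγ2 hgm hk
    exact ⟨orth_bot hkm hX, orth_top hkm hX, fun τ hτ => orth_mul_pow hkm hX h hτ.le,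
      fun ω t G hT => ⟨exists_isDecomp hmax hγ0 hγ2 hgm hgi hP0 hk G,
        fun δ A hD => orth_typeIII_charPSq hkm hX h hMu hQP hT hD⟩,
      fun ω t G μ hT => ⟨exists_isDecomp hmax hγ0 hγ2 hgm hgi hP0 hk G,
        fun δ A hD => orth_typeIV_charPSq hkm hX h hMu hQP hT hD⟩⟩
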